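/- Let $\mathbb F$ be an algebraically closed field and let $q\in\mathbb F$ be nonzero and not a root of unity. Let $\triangle_q$ be the unital associative $\mathbb F$-algebra with generators $A,B,C$ and relations stating that each of $$A+\frac{qBC-q^{-1}CB}{q^2-q^{-2}},\qquad B+\frac{qCA-q^{-1}AC}{q^2-q^{-2}},\qquad C+\frac{qAB-q^{-1}BA}{q^2-q^{-2}}$$ commutes with $A,B,C$. Let $\mathfrak H_q$ be the unital associative $\mathbb F$-algebra with generators $t_i^{\pm1}$ $(i=0,1,2,3)$ and relations $t_it_i^{-1}=t_i^{-1}t_i=1$, $t_i+t_i^{-1}$ is central for each $i$, and $t_0t_1t_2t_3=q^{-1}$. Every $\mathfrak H_q$-module is viewed as a $\triangle_q$-module via the algebra homomorphism $\zeta:\triangle_q\to\mathfrak H_q$ with $$A\mapsto t_1t_0+(t_1t_0)^{-1},\qquad B\mapsto t_3t_0+(t_3t_0)^{-1},\qquad C\mapsto t_2t_0+(t_2t_0)^{-1}.$$ For an $\mathfrak H_q$-module $V$ and $\theta\in\mathbb F$ put $V(\theta)=\{v\in V\mid t_0v=\theta v\}$; this is a $\triangle_q$-submodule of $V$. Let $d\ge1$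 be an odd integer and let $k_0,k_1,k_2,k_3\in\mathbb F$ be nonzero with $k_0^2=q^{-d-1}$. Let $E=E(k_0,k_1,k_2,k_3)$ be the $(d+1)$-dimensional $\mathfrak H_q$-module with basis $v_0,\dots,v_d$ on which, with $v_{d+1}:=0$ and $\varrho_i=(k_0k_1k_3q^i-k_2)(k_0k_1k_3q^i-k_2^{-1})$ for odd $i$, $\varrho_i=(1-q^i)(1-k_0^2q^i)$ for even $i$ (so that $\varrho_0=0$ and the terms with $\varrho_0 v_{-1}$ are absent): * for even $i$ with $0\le i\le d-1$: $t_0v_i=k_0^{-1}q^{-i}\varrho_iv_{i-1}+(k_0+k_0^{-1}-k_0^{-1}q^{-i})v_i$, $t_1v_i=-k_1\varrho_iv_{i-1}+k_1v_i+k_1^{-1}v_{i+1}$, $t_2v_i=k_0^{-1}k_1^{-1}k_3^{-1}q^{-i-1}(v_i-v_{i+1})$, $t_3v_i=k_3v_i$; * for odd $i$ with $1\le i\le d$: $t_0v_i=k_0^{-1}q^{-i-1}(v_i-v_{i+1})$, $t_1v_i=k_1^{-1}v_i$, $t_2v_i=\dfrac{\varrho_i}{k_0k_1k_3q^i}v_{i-1}+(k_2+k_2^{-1}-k_0^{-1}k_1^{-1}k_3^{-1}q^{-i})v_i$,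 $t_3v_i=-k_3^{-1}\varrho_iv_{i-1}+k_3^{-1}v_i+k_3v_{i+1}$. Let $E^{1}=E(k_0,k_1,k_2,k_3)^{1\bmod 4}$ be the $\mathfrak H_q$-module obtained by twisting $E$ by the automorphism $t_0\mapsto t_1,\ t_1\mapsto t_2,\ t_2\mapsto t_3,\ t_3\mapsto t_0$ of $\mathfrak H_q$ (so $t_i$ acts on $E^1$ as $t_{i+1}$, index modulo $4$, acts on $E$). **Theorem.** Assume that the $\mathfrak H_q$-module $E^1$ is irreducible. 1. If $k_1^2=1$, then the $\triangle_q$-submodules of $E^1$ are exactly $\{0\}$, $E^1(k_1)$ and $E^1$, and their lattice is the three-element chain $\{0\}\subsetneq E^1(k_1)\subsetneq E^1$. 2. If $k_1^2\ne1$, then the $\triangle_q$-submodules of $E^1$ are exactly $\{0\}$, $E^1(k_1)$, $E^1(k_1^{-1})$ and $E^1$; these four are distinct, and their lattice is the diamond in which $E^1(k_1)$ and $E^1(k_1^{-1})$ are incomparable, each covering $\{0\}$ and each covered by $E^1$. -/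

import Mathlib

namespace DAHA

/-- `q` is nonzero and not a root of unity. -/
class NotRootOfUnity {F : Type*} [Field F] (q : F) : Prop where
  ne_zero : q ≠ 0
  pow_ne_one : ∀ n : ℕ, 0 < n → q ^ n ≠ 1

/-! ### The universal Askey--Wilson algebra -/

/-- The generators `A, B, C` of the universal Askey--Wilson algebra. -/
inductive AWGen : Type
  | A | B | C

/-- The element `x + (q y z - q⁻¹ z y) / (q² - q⁻²)`. -/
def awExpr {F : Type*} [Field F] {R : Type*} [Ring R] [Algebra F R] (q : F) (x y z : R) : R :=
  x + (q ^ 2 - q⁻¹ ^ 2)⁻¹ • (q • (y * z) - q⁻¹ • (z * y))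

/-- The defining relations: each of the three expressions commutes with `A, B, C`. -/
inductive AWRel {F : Type*} [Field F] (q : F) : FreeAlgebra F AWGen → FreeAlgebra F AWGen → Prop
  | relA (g : AWGen) : AWRel q
      (awExpr q (FreeAlgebra.ι F AWGen.A) (FreeAlgebra.ι F AWGen.B) (FreeAlgebra.ι F AWGen.C) *
        FreeAlgebra.ι F g)
      (FreeAlgebra.ι F g *
        awExpr q (FreeAlgebra.ι F AWGen.A) (FreeAlgebra.ι F AWGen.B) (FreeAlgebra.ι F AWGen.C))
  | relB (g : AWGen) : AWRel q
      (awExpr q (FreeAlgebra.ι F AWGen.B) (FreeAlgebra.ι F AWGen.C) (FreeAlgebra.ι F AWGen.A) *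
        FreeAlgebra.ι F g)
      (FreeAlgebra.ι F g *
        awExpr q (FreeAlgebra.ι F AWGen.B) (FreeAlgebra.ι F AWGen.C) (FreeAlgebra.ι F AWGen.A))
  | relC (g : AWGen) : AWRel q
      (awExpr q (FreeAlgebra.ι F AWGen.C) (FreeAlgebra.ι F AWGen.A) (FreeAlgebra.ι F AWGen.B) *
        FreeAlgebra.ι F g)
      (FreeAlgebra.ι F g *
        awExpr q (FreeAlgebra.ι F AWGen.C) (FreeAlgebra.ι F AWGen.A) (FreeAlgebra.ι F AWGen.B))

/-- The universal Askey--Wilson algebra `△_q`. -/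
def UAW {F : Type*} [Field F] (q : F) : Type _ := RingQuot (AWRel q)

noncomputable instance {F : Type*} [Field F] (q : F) : Ring (UAW q) :=
  inferInstanceAs (Ring (RingQuot (AWRel q)))

noncomputable instance {F : Type*} [Field F] (q : F) : Algebra F (UAW q) :=
  inferInstanceAs (Algebra F (RingQuot (AWRel q)))

/-- The generators as elements of `△_q`. -/
noncomputable def UAW.gen {F : Type*} [Field F] (q : F) (g : AWGen) : UAW q :=
  RingQuot.mkAlgHom F (AWRel q) (FreeAlgebra.ι F g)

/-! ### The universal DAHA of type `(C₁^∨, C₁)` -/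

/-- The generators `t i` and their inverses `tinv i`, for `i = 0, 1, 2, 3` modulo `4`. -/
inductive HGen : Type
  | t (i : ZMod 4)
  | tinv (i : ZMod 4)

/-- The defining relations of the universal DAHA. -/
inductive HRel {F : Type*} [Field F] (q : F) : FreeAlgebra F HGen → FreeAlgebra F HGen → Prop
  | mul_inv (i : ZMod 4) : HRel q
      (FreeAlgebra.ι F (HGen.t i) * FreeAlgebra.ι F (HGen.tinv i)) 1
  | inv_mul (i : ZMod 4) : HRel q
      (FreeAlgebra.ι F (HGen.tinv i) * FreeAlgebra.ι F (HGen.t i)) 1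
  | central (i : ZMod 4) (x : FreeAlgebra F HGen) : HRel q
      ((FreeAlgebra.ι F (HGen.t i) + FreeAlgebra.ι F (HGen.tinv i)) * x)
      (x * (FreeAlgebra.ι F (HGen.t i) + FreeAlgebra.ι F (HGen.tinv i)))
  | prod : HRel q
      (FreeAlgebra.ι F (HGen.t 0) * FreeAlgebra.ι F (HGen.t 1) *
        FreeAlgebra.ι F (HGen.t 2) * FreeAlgebra.ι F (HGen.t 3))
      (algebraMap F (FreeAlgebra F HGen) q⁻¹)

/-- The universal DAHA `𝔥_q` of type `(C₁^∨, C₁)`. -/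
def H {F : Type*} [Field F] (q : F) : Type _ := RingQuot (HRel q)

noncomputable instance {F : Type*} [Field F] (q : F) : Ring (H q) :=
  inferInstanceAs (Ring (RingQuot (HRel q)))

noncomputable instance {F : Type*} [Field F] (q : F) : Algebra F (H q) :=
  inferInstanceAs (Algebra F (RingQuot (HRel q)))

/-- The generator `t_i`. -/
noncomputable def H.t {F : Type*} [Field F] (q : F) (i : ZMod 4) : H q :=
  RingQuot.mkAlgHom F (HRel q) (FreeAlgebra.ι F (HGen.t i))

/-- The generator `t_i⁻¹`. -/
noncomputable def H.tinv {F : Type*} [Field F] (q : F) (i : ZMod 4) : H q :=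
  RingQuot.mkAlgHom F (HRel q) (FreeAlgebra.ι F (HGen.tinv i))

section HBasics

variable {F : Type*} [Field F] (q : F)

theorem H.t_mul_tinv (i : ZMod 4) : H.t q i * H.tinv q i = 1 := by
  have := RingQuot.mkAlgHom_rel F (HRel.mul_inv (q := q) i)
  rwa [map_mul, map_one] at this

theorem H.tinv_mul_t (i : ZMod 4) : H.tinv q i * H.t q i = 1 := by
  have := RingQuot.mkAlgHom_rel F (HRel.inv_mul (q := q) i)
  rwa [map_mul, map_one] at this

theorem H.central (i : ZMod 4) (x : H q) :
    (H.t q i + H.tinv q i) * x = x * (H.t q i + H.tinv q i) := by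
  obtain ⟨y, rfl⟩ := RingQuot.mkAlgHom_surjective F (HRel q) x
  have := RingQuot.mkAlgHom_rel F (HRel.central (q := q) i y)
  rwa [map_mul, map_mul, map_add] at this

theorem H.prod : H.t q 0 * H.t q 1 * H.t q 2 * H.t q 3 = algebraMap F (H q) q⁻¹ := by
  have := RingQuot.mkAlgHom_rel F (HRel.prod (q := q))
  rwa [map_mul, map_mul, map_mul, AlgHom.commutes] at this

/-- An algebra homomorphism out of `𝔥_q` from images of the generators. -/
noncomputable def H.lift {R : Type*} [Ring R] [Algebra F R] (f g : ZMod 4 → R)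
    (h1 : ∀ i, f i * g i = 1) (h2 : ∀ i, g i * f i = 1)
    (h3 : ∀ i x, (f i + g i) * x = x * (f i + g i))
    (h4 : f 0 * f 1 * f 2 * f 3 = algebraMap F R q⁻¹) : H q →ₐ[F] R :=
  RingQuot.liftAlgHom F
    ⟨FreeAlgebra.lift F (fun x : HGen => match x with | .t i => f i | .tinv i => g i), by
      intro x y h
      cases h with
      | mul_inv i => simpa using h1 i
      | inv_mul i => simpa using h2 i
      | central i x => simpa using h3 i _
      | prod => simpa using h4⟩

theorem H.lift_t {R : Type*} [Ring R] [Algebra F R] (f g : ZMod 4 → R) (h1 h2 h3 h4)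
    (i : ZMod 4) : H.lift q f g h1 h2 h3 h4 (H.t q i) = f i := by
  simp only [H.lift, H.t]
  erw [RingQuot.liftAlgHom_mkAlgHom_apply]
  simp

theorem H.lift_tinv {R : Type*} [Ring R] [Algebra F R] (f g : ZMod 4 → R) (h1 h2 h3 h4)
    (i : ZMod 4) : H.lift q f g h1 h2 h3 h4 (H.tinv q i) = g i := by
  simp only [H.lift, H.tinv]
  erw [RingQuot.liftAlgHom_mkAlgHom_apply]
  simp

theorem H.hom_ext {R : Type*} [Ring R] [Algebra F R] {φ ψ : H q →ₐ[F] R}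
    (h1 : ∀ i, φ (H.t q i) = ψ (H.t q i)) (h2 : ∀ i, φ (H.tinv q i) = ψ (H.tinv q i)) :
    φ = ψ := by
  refine RingQuot.ringQuot_ext' F φ ψ ?_
  ext x
  cases x with
  | t i => exact h1 i
  | tinv i => exact h2 i

theorem H.cyc {R : Type*} [Ring R] [Algebra F R] {a b x : R} (r : F)
    (h2 : b * a = 1) (h : a * x = algebraMap F R r) :
    x * a = algebraMap F R r := by
  have hx : x = b * algebraMap F R r := by rw [← h, ← mul_assoc, h2, one_mul]
  rw [hx, mul_assoc, Algebra.commutes, ← mul_assoc, h2, one_mul]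

theorem H.prod_shift (e : ZMod 4) :
    H.t q (0 + e) * H.t q (1 + e) * H.t q (2 + e) * H.t q (3 + e) = algebraMap F (H q) q⁻¹ := by
  have h0 := H.prod q
  have h1 : H.t q 1 * H.t q 2 * H.t q 3 * H.t q 0 = algebraMap F (H q) q⁻¹ :=
    H.cyc q⁻¹ (H.tinv_mul_t q 0) (by simpa only [mul_assoc] using h0)
  have h2 : H.t q 2 * H.t q 3 * H.t q 0 * H.t q 1 = algebraMap F (H q) q⁻¹ :=
    H.cyc q⁻¹ (H.tinv_mul_t q 1) (by simpa only [mul_assoc] using h1)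
  have h3 : H.t q 3 * H.t q 0 * H.t q 1 * H.t q 2 = algebraMap F (H q) q⁻¹ :=
    H.cyc q⁻¹ (H.tinv_mul_t q 2) (by simpa only [mul_assoc] using h2)
  fin_cases e
  · exact h0
  · exact h1
  · exact h2
  · exact h3

/-- The endomorphism `t_i ↦ t_{i+e}`. -/
noncomputable def H.shiftHom (e : ZMod 4) : H q →ₐ[F] H q :=
  H.lift q (fun i => H.t q (i + e)) (fun i => H.tinv q (i + e))
    (fun _ => H.t_mul_tinv q _) (fun _ => H.tinv_mul_t q _) (fun _ x => H.central q _ x)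
    (H.prod_shift q e)

/-- The action of `ℤ/4ℤ` on `𝔥_q`: the class `e` acts as the automorphism `t_i ↦ t_{i+e}`. -/
noncomputable def H.shift (e : ZMod 4) : H q ≃ₐ[F] H q :=
  AlgEquiv.ofAlgHom (H.shiftHom q e) (H.shiftHom q (-e))
    (H.hom_ext q (by intro i; simp [H.shiftHom, H.lift_t]) (by
      intro i; simp [H.shiftHom, H.lift_tinv]))
    (H.hom_ext q (by intro i; simp [H.shiftHom, H.lift_t]) (by
      intro i; simp [H.shiftHom, H.lift_tinv]))

end HBasics

/-! ### The homomorphism `ζ : △_q → 𝔥_q` -/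

/-- `t_i t_0 + (t_i t_0)⁻¹`. -/
noncomputable def H.pair {F : Type*} [Field F] (q : F) (i : ZMod 4) : H q :=
  H.t q i * H.t q 0 + H.tinv q 0 * H.tinv q i

section Zeta

theorem pair_symm {R : Type*} [Ring R] {u u' v v' : R}
    (hu : ∀ x, (u + u') * x = x * (u + u')) (hv : ∀ x, (v + v') * x = x * (v + v')) :
    u * v + v' * u' = v * u + u' * v' := by
  have h1 := hu v
  have h2 := hv u'
  have e : (u * v + v' * u') - (v * u + u' * v') =
      ((u + u') * v - v * (u + u')) + ((v + v') * u' - u' * (v + v')) := by noncomm_ring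
  rw [← sub_eq_zero, e, h1, h2, sub_self, sub_self, add_zero]

theorem pair_commute {R : Type*} [Ring R] {u u' v v' : R}
    (hu : ∀ x, (u + u') * x = x * (u + u')) (hv : ∀ x, (v + v') * x = x * (v + v'))
    (h1 : u * u' = 1) (h2 : u' * u = 1) :
    u * (v * u + u' * v') = (v * u + u' * v') * u := by
  conv_lhs => rw [← pair_symm hu hv]
  have e1 : u * (u * v + v' * u') = u * (u * v + v' * u') * (u' * u) := by rw [h2, mul_one]
  have h3 := pair_symm hu hv
  calc u * (u * v + v' * u') = u * (v * u + u' * v') := by rw [h3]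
    _ = u * v * u + u * u' * v' := by noncomm_ring
    _ = u * v * u + v' * (u' * u) := by rw [h1, h2]; noncomm_ring
    _ = (u * v + v' * u') * u := by noncomm_ring
    _ = _ := by rw [h3]

theorem key_identity {F : Type*} [Field F] {R : Type*} [Ring R] [Algebra F R] (q : F) (hq : q ≠ 0)
    {t0 t1 t2 t3 s0 s1 s2 s3 : R}
    (h0 : ∀ x, (t0 + s0) * x = x * (t0 + s0)) (h1 : ∀ x, (t1 + s1) * x = x * (t1 + s1))
    (h2 : ∀ x, (t2 + s2) * x = x * (t2 + s2)) (h3 : ∀ x, (t3 + s3) * x = x * (t3 + s3))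
    (a0 : t0 * s0 = 1) (b0 : s0 * t0 = 1) (b1 : s1 * t1 = 1)
    (a2 : t2 * s2 = 1) (b2 : s2 * t2 = 1) (a3 : t3 * s3 = 1)
    (hp : t0 * t1 * t2 * t3 = algebraMap F R q⁻¹) :
    (q ^ 2 - q⁻¹ ^ 2) • (t1 * t0 + s0 * s1) +
      (q • ((t3 * t0 + s0 * s3) * (t2 * t0 + s0 * s2)) -
       q⁻¹ • ((t2 * t0 + s0 * s2) * (t3 * t0 + s0 * s3))) =
    (q - q⁻¹) • ((t3 + s3) * (t2 + s2) + (t1 + s1) * (q • s0 + q⁻¹ • t0)) := by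
  have hWW : s2 * s1 * s0 * (t0 * t1 * t2) = 1 := by
    calc s2 * s1 * s0 * (t0 * t1 * t2) = s2 * (s1 * (s0 * t0) * t1) * t2 := by noncomm_ring
      _ = 1 := by rw [b0, mul_one, b1, mul_one, b2]
  have ht3 : t3 = q⁻¹ • (s2 * s1 * s0) := by
    calc t3 = s2 * s1 * s0 * (t0 * t1 * t2) * t3 := by rw [hWW, one_mul]
      _ = s2 * s1 * s0 * (t0 * t1 * t2 * t3) := by noncomm_ring
      _ = _ := by rw [hp, ← Algebra.commutes, Algebra.smul_def]
  have hs3 : s3 = q • (t0 * t1 * t2) := by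
    have : t0 * t1 * t2 = q⁻¹ • s3 := by
      calc t0 * t1 * t2 = t0 * t1 * t2 * t3 * s3 := by rw [mul_assoc _ t3, a3, mul_one]
        _ = _ := by rw [hp, Algebra.smul_def]
    rw [this, smul_smul, mul_inv_cancel₀ hq, one_smul]
  have hB : t3 * t0 + s0 * s3 = q • (t1 * t2) + q⁻¹ • (s2 * s1) := by
    rw [ht3, hs3, smul_mul_assoc, mul_smul_comm, mul_assoc (s2 * s1), b0, mul_one,
      ← mul_assoc, ← mul_assoc, b0, one_mul, add_comm]
  have hA : t1 * t0 + s0 * s1 = t0 * t1 + s1 * s0 := (pair_symm h0 h1).symm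
  have hC : t2 * t0 + s0 * s2 = t0 * t2 + s2 * s0 := (pair_symm h0 h2).symm
  have hBt : t0 * (t3 * t0 + s0 * s3) = (t3 * t0 + s0 * s3) * t0 := pair_commute h0 h3 a0 b0
  rw [hA, hC]
  rw [hB] at hBt ⊢
  have hBs : s0 * (q • (t1 * t2) + q⁻¹ • (s2 * s1)) =
      (q • (t1 * t2) + q⁻¹ • (s2 * s1)) * s0 := by
    generalize q • (t1 * t2) + q⁻¹ • (s2 * s1) = b at hBt
    calc s0 * b = s0 * (b * (t0 * s0)) := by rw [a0, mul_one]
      _ = s0 * (b * t0) * s0 := by noncomm_ring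
      _ = (s0 * t0) * b * s0 := by rw [← hBt]; noncomm_ring
      _ = _ := by rw [b0, one_mul]
  have eBC : (q • (t1 * t2) + q⁻¹ • (s2 * s1)) * (t0 * t2 + s2 * s0) =
      q • (t0 * t1 * t2 * t2) + q⁻¹ • (t0 * s2 * s1 * t2) + q • (t1 * s0) +
        q⁻¹ • (s2 * s1 * s2 * s0) := by
    have e : t1 * s0 = t1 * (t2 * s2) * s0 := by rw [a2, mul_one]
    rw [mul_add, ← mul_assoc, ← hBt, e]
    simp only [mul_add, add_mul, smul_mul_assoc, mul_smul_comm, mul_assoc]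
    abel
  have eCB : (t0 * t2 + s2 * s0) * (q • (t1 * t2) + q⁻¹ • (s2 * s1)) =
      q • (t0 * t2 * t1 * t2) + q⁻¹ • (t0 * s1) + q • (s2 * t1 * t2 * s0) +
        q⁻¹ • (s2 * s2 * s1 * s0) := by
    have e : t0 * s1 = t0 * (t2 * s2) * s1 := by rw [a2, mul_one]
    rw [add_mul, mul_assoc s2, hBs, e]
    simp only [mul_add, add_mul, smul_mul_assoc, mul_smul_comm, mul_assoc]
    abel
  have e1 : t0 * t1 * t2 * t2 + t0 * t1 = (t2 + s2) * (t0 * t1 * t2) := by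
    rw [h2, mul_add, mul_assoc (t0 * t1) t2 s2, a2, mul_one]
  have e2 : s2 * s2 * s1 * s0 + s1 * s0 = (t2 + s2) * (s2 * s1 * s0) := by
    rw [add_mul, ← mul_assoc, ← mul_assoc, a2]; noncomm_ring
  have e3 : t0 * s2 * s1 * t2 + t0 * s2 * t1 * t2 = (t1 + s1) * t0 := by
    calc _ = t0 * s2 * ((t1 + s1) * t2) := by noncomm_ring
      _ = t0 * (s2 * t2) * (t1 + s1) := by rw [h1]; noncomm_ring
      _ = _ := by rw [b2, mul_one, h1]
  have e4 : t0 * s2 * t1 * t2 + t0 * t2 * t1 * t2 = (t2 + s2) * (t0 * t1 * t2) := by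
    calc _ = t0 * ((t2 + s2) * (t1 * t2)) := by noncomm_ring
      _ = _ := by rw [h2, h2]; noncomm_ring
  have e5 : s2 * t1 * t2 * s0 + s2 * s1 * t2 * s0 = (t1 + s1) * s0 := by
    calc _ = s2 * ((t1 + s1) * (t2 * s0)) := by noncomm_ring
      _ = (s2 * t2) * s0 * (t1 + s1) := by rw [h1]; noncomm_ring
      _ = _ := by rw [b2, one_mul, h1]
  have e6 : s2 * s1 * s2 * s0 + s2 * s1 * t2 * s0 = (t2 + s2) * (s2 * s1 * s0) := by
    calc _ = s2 * s1 * ((t2 + s2) * s0) := by noncomm_ring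
      _ = _ := by rw [h2, h2]; noncomm_ring
  have e7 : s1 * s0 + t1 * s0 = (t1 + s1) * s0 := by noncomm_ring
  have e8 : t0 * t1 + t0 * s1 = (t1 + s1) * t0 := by rw [h1]; noncomm_ring
  have e9 : (t3 + s3) * (t2 + s2) =
      q⁻¹ • ((t2 + s2) * (s2 * s1 * s0)) + q • ((t2 + s2) * (t0 * t1 * t2)) := by
    rw [← h2, ht3, hs3, mul_add, mul_smul_comm, mul_smul_comm]
  rw [eBC, eCB, e9, mul_add, mul_smul_comm, mul_smul_comm]
  generalize (t2 + s2) * (s2 * s1 * s0) = P' at *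
  generalize (t2 + s2) * (t0 * t1 * t2) = P at *
  generalize (t1 + s1) * s0 = N at *
  generalize (t1 + s1) * t0 = M at *
  rw [eq_sub_of_add_eq e1, eq_sub_of_add_eq e2, eq_sub_of_add_eq e3,
    eq_sub_of_add_eq' e4, eq_sub_of_add_eq e5, eq_sub_of_add_eq e6, eq_sub_of_add_eq' e7,
    eq_sub_of_add_eq' e8]
  match_scalars <;> field_simp <;> ring

theorem awExpr_commute {F : Type*} [Field F] {R : Type*} [Ring R] [Algebra F R] (q : F)
    [hq : NotRootOfUnity q] {t0 t1 t2 t3 s0 s1 s2 s3 g : R}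
    (h0 : ∀ x, (t0 + s0) * x = x * (t0 + s0)) (h1 : ∀ x, (t1 + s1) * x = x * (t1 + s1))
    (h2 : ∀ x, (t2 + s2) * x = x * (t2 + s2)) (h3 : ∀ x, (t3 + s3) * x = x * (t3 + s3))
    (a0 : t0 * s0 = 1) (b0 : s0 * t0 = 1) (b1 : s1 * t1 = 1)
    (a2 : t2 * s2 = 1) (b2 : s2 * t2 = 1) (a3 : t3 * s3 = 1)
    (hp : t0 * t1 * t2 * t3 = algebraMap F R q⁻¹) (hg : t0 * g = g * t0) :
    awExpr q (t1 * t0 + s0 * s1) (t3 * t0 + s0 * s3) (t2 * t0 + s0 * s2) * g =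
      g * awExpr q (t1 * t0 + s0 * s1) (t3 * t0 + s0 * s3) (t2 * t0 + s0 * s2) := by
  have hq0 : q ≠ 0 := hq.ne_zero
  have hz : q ^ 2 - q⁻¹ ^ 2 ≠ 0 := by
    intro h
    apply hq.pow_ne_one 4 (by norm_num)
    field_simp at h
    linear_combination h
  have key := key_identity q hq0 h0 h1 h2 h3 a0 b0 b1 a2 b2 a3 hp
  have hgs : s0 * g = g * s0 := by
    have := h0 g
    rw [add_mul, mul_add, hg] at this
    exact add_left_cancel this
  have e : awExpr q (t1 * t0 + s0 * s1) (t3 * t0 + s0 * s3) (t2 * t0 + s0 * s2) =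
      (q ^ 2 - q⁻¹ ^ 2)⁻¹ • ((q - q⁻¹) • ((t3 + s3) * (t2 + s2) +
        (t1 + s1) * (q • s0 + q⁻¹ • t0))) := by
    rw [← key, smul_add, smul_smul, inv_mul_cancel₀ hz, one_smul, awExpr]
  have hk : (q • s0 + q⁻¹ • t0) * g = g * (q • s0 + q⁻¹ • t0) := by
    rw [add_mul, mul_add, smul_mul_assoc, smul_mul_assoc, mul_smul_comm, mul_smul_comm, hg, hgs]
  rw [e]
  simp only [smul_mul_assoc, mul_smul_comm]
  congr 2
  have k1 : (t3 + s3) * (t2 + s2) * g = g * ((t3 + s3) * (t2 + s2)) := by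
    rw [mul_assoc, h2 g, ← mul_assoc, h3 g, mul_assoc]
  have k2 : (t1 + s1) * (q • s0 + q⁻¹ • t0) * g = g * ((t1 + s1) * (q • s0 + q⁻¹ • t0)) := by
    rw [mul_assoc, hk, ← mul_assoc, h1 g, mul_assoc]
  rw [add_mul, k1, k2, ← mul_add]

variable {F : Type*} [Field F] (q : F)

theorem H.pair_t0 (i : ZMod 4) : H.t q 0 * H.pair q i = H.pair q i * H.t q 0 :=
  pair_commute (H.central q 0) (H.central q i) (H.t_mul_tinv q 0) (H.tinv_mul_t q 0)

/-- Conjugation of `t_i` by `t_0`, and the facts about it that are used below. -/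
theorem H.conj_facts (i : ZMod 4) :
    (∀ x, (H.tinv q 0 * H.t q i * H.t q 0 + H.tinv q 0 * H.tinv q i * H.t q 0) * x =
      x * (H.tinv q 0 * H.t q i * H.t q 0 + H.tinv q 0 * H.tinv q i * H.t q 0)) ∧
    (H.tinv q 0 * H.t q i * H.t q 0) * (H.tinv q 0 * H.tinv q i * H.t q 0) = 1 ∧
    (H.tinv q 0 * H.tinv q i * H.t q 0) * (H.tinv q 0 * H.t q i * H.t q 0) = 1 ∧
    H.tinv q 0 * H.t q i * H.t q 0 * H.t q 0 + H.tinv q 0 * (H.tinv q 0 * H.tinv q i * H.t q 0) =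
      H.pair q i := by
  have a := H.t_mul_tinv q 0
  have b := H.tinv_mul_t q 0
  have ai := H.t_mul_tinv q i
  have bi := H.tinv_mul_t q i
  have c := H.central q i
  have p := H.pair_t0 q i
  generalize hP : H.pair q i = P at *
  rw [H.pair] at hP
  generalize H.t q 0 = u at *
  generalize H.tinv q 0 = u' at *
  generalize H.t q i = v at *
  generalize H.tinv q i = v' at *
  refine ⟨?_, ?_, ?_, ?_⟩
  · have e : u' * v * u + u' * v' * u = v + v' := by
      calc _ = u' * ((v + v') * u) := by noncomm_ring
        _ = (u' * u) * (v + v') := by rw [c]; noncomm_ring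
        _ = _ := by rw [b, one_mul]
    rw [e]; exact c
  · calc _ = u' * v * (u * u') * v' * u := by noncomm_ring
      _ = u' * (v * v') * u := by rw [a]; noncomm_ring
      _ = 1 := by rw [ai, mul_one, b]
  · calc _ = u' * v' * (u * u') * v * u := by noncomm_ring
      _ = u' * (v' * v) * u := by rw [a]; noncomm_ring
      _ = 1 := by rw [bi, mul_one, b]
  · calc _ = u' * ((v * u + u' * v') * u) := by noncomm_ring
      _ = (u' * u) * P := by rw [hP, ← p]; noncomm_ring
      _ = P := by rw [b, one_mul]

theorem H.relA [NotRootOfUnity q] (g : H q) (hg : H.t q 0 * g = g * H.t q 0) :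
    awExpr q (H.pair q 1) (H.pair q 3) (H.pair q 2) * g =
      g * awExpr q (H.pair q 1) (H.pair q 3) (H.pair q 2) :=
  awExpr_commute q (H.central q 0) (H.central q 1) (H.central q 2) (H.central q 3)
    (H.t_mul_tinv q 0) (H.tinv_mul_t q 0) (H.tinv_mul_t q 1) (H.t_mul_tinv q 2)
    (H.tinv_mul_t q 2) (H.t_mul_tinv q 3) (H.prod q) hg

theorem H.relB [NotRootOfUnity q] (g : H q) (hg : H.t q 0 * g = g * H.t q 0) :
    awExpr q (H.pair q 3) (H.pair q 2) (H.pair q 1) * g =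
      g * awExpr q (H.pair q 3) (H.pair q 2) (H.pair q 1) := by
  obtain ⟨c1, -, c3, c4⟩ := H.conj_facts q 3
  have := awExpr_commute q (H.central q 0) c1 (H.central q 1) (H.central q 2)
    (H.t_mul_tinv q 0) (H.tinv_mul_t q 0) c3 (H.t_mul_tinv q 1)
    (H.tinv_mul_t q 1) (H.t_mul_tinv q 2) (by
      have h : H.t q 3 * H.t q 0 * H.t q 1 * H.t q 2 = algebraMap F (H q) q⁻¹ :=
        H.prod_shift q 3
      rw [← h, ← mul_assoc, ← mul_assoc, H.t_mul_tinv, one_mul]) hg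
  rwa [c4] at this

theorem H.relC [NotRootOfUnity q] (g : H q) (hg : H.t q 0 * g = g * H.t q 0) :
    awExpr q (H.pair q 2) (H.pair q 1) (H.pair q 3) * g =
      g * awExpr q (H.pair q 2) (H.pair q 1) (H.pair q 3) := by
  obtain ⟨c1, -, c3, c4⟩ := H.conj_facts q 2
  obtain ⟨d1, d2, d3, d4⟩ := H.conj_facts q 3
  have := awExpr_commute q (H.central q 0) c1 d1 (H.central q 1)
    (H.t_mul_tinv q 0) (H.tinv_mul_t q 0) c3 d2 d3 (H.t_mul_tinv q 1) (by
      have h : H.t q 2 * H.t q 3 * H.t q 0 * H.t q 1 = algebraMap F (H q) q⁻¹ :=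
        H.prod_shift q 2
      have a := H.t_mul_tinv q 0
      rw [← h]
      generalize H.t q 0 = u at *
      generalize H.tinv q 0 = u' at *
      calc _ = (u * u') * H.t q 2 * (u * u') * H.t q 3 * u * H.t q 1 := by noncomm_ring
        _ = _ := by rw [a, one_mul, mul_one]) hg
  rwa [c4, d4] at this

/-- The images `t_1 t_0 + (t_1 t_0)⁻¹`, `t_3 t_0 + (t_3 t_0)⁻¹`, `t_2 t_0 + (t_2 t_0)⁻¹`
of `A`, `B`, `C` under `ζ`. -/
noncomputable def zetaGen : AWGen → H q
  | .A => H.pair q 1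
  | .B => H.pair q 3
  | .C => H.pair q 2

theorem zetaGen_t0 (g : AWGen) : H.t q 0 * zetaGen q g = zetaGen q g * H.t q 0 := by
  cases g <;> exact H.pair_t0 q _

/-- The algebra homomorphism `ζ : △_q → 𝔥_q`. -/
noncomputable def zeta [NotRootOfUnity q] : UAW q →ₐ[F] H q :=
  RingQuot.liftAlgHom F
    ⟨FreeAlgebra.lift F (zetaGen q), by
      intro x y h
      cases h with
      | relA g => simpa [awExpr, zetaGen] using H.relA q (zetaGen q g) (zetaGen_t0 q g)
      | relB g => simpa [awExpr, zetaGen] using H.relB q (zetaGen q g) (zetaGen_t0 q g)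
      | relC g => simpa [awExpr, zetaGen] using H.relC q (zetaGen q g) (zetaGen_t0 q g)⟩

theorem zeta_gen [NotRootOfUnity q] (g : AWGen) : zeta q (UAW.gen q g) = zetaGen q g := by
  simp only [zeta, UAW.gen]
  erw [RingQuot.liftAlgHom_mkAlgHom_apply]
  simp

theorem zeta_t0 [NotRootOfUnity q] (x : UAW q) : H.t q 0 * zeta q x = zeta q x * H.t q 0 := by
  obtain ⟨y, rfl⟩ := RingQuot.mkAlgHom_surjective F (AWRel q) x
  induction y using FreeAlgebra.induction with
  | grade0 r =>
    have : zeta q (RingQuot.mkAlgHom F (AWRel q) (algebraMap F _ r)) = algebraMap F (H q) r := by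
      rw [AlgHom.commutes]; exact (zeta q).commutes r
    rw [this, Algebra.commutes]
  | grade1 g =>
    have := zetaGen_t0 q g
    rwa [← zeta_gen] at this
  | mul a b ha hb =>
    have e : zeta q (RingQuot.mkAlgHom F (AWRel q) (a * b)) =
        zeta q (RingQuot.mkAlgHom F (AWRel q) a) * zeta q (RingQuot.mkAlgHom F (AWRel q) b) := by
      rw [map_mul]; exact map_mul (zeta q) _ _
    rw [e, ← mul_assoc, ha, mul_assoc, hb, mul_assoc]
  | add a b ha hb =>
    have e : zeta q (RingQuot.mkAlgHom F (AWRel q) (a + b)) =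
        zeta q (RingQuot.mkAlgHom F (AWRel q) a) + zeta q (RingQuot.mkAlgHom F (AWRel q) b) := by
      rw [map_add]; exact map_add (zeta q) _ _
    rw [e, mul_add, add_mul, ha, hb]

end Zeta

/-! ### Modules -/

/-- The twist `V^ε` of an `𝔥_q`-module `V` by an automorphism `ε`. -/
def Twist {F : Type*} [Field F] {q : F} (_ε : H q ≃ₐ[F] H q) (V : Type*) : Type _ := V

section Modules

variable {F : Type*} [Field F] {q : F}

instance (ε : H q ≃ₐ[F] H q) (V : Type*) [AddCommGroup V] : AddCommGroup (Twist ε V) :=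
  inferInstanceAs (AddCommGroup V)

instance (ε : H q ≃ₐ[F] H q) (V : Type*) [AddCommGroup V] [Module F V] : Module F (Twist ε V) :=
  inferInstanceAs (Module F V)

/-- On `V^ε` an element `x` acts as `ε x` acts on `V`. -/
noncomputable instance (ε : H q ≃ₐ[F] H q) (V : Type*) [AddCommGroup V] [Module (H q) V] :
    Module (H q) (Twist ε V) :=
  Module.compHom V (ε : H q →+* H q)

instance (ε : H q ≃ₐ[F] H q) (V : Type*) [AddCommGroup V] [Module F V] [Module (H q) V]
    [IsScalarTower F (H q) V] : IsScalarTower F (H q) (Twist ε V) where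
  smul_assoc a x v := by
    have h : ∀ w : V, ε (a • x) • w = a • ε x • w := fun w => by rw [map_smul, smul_assoc]
    exact h v

/-- Each `𝔥_q`-module is viewed as a `△_q`-module by pulling back via `ζ`. -/
noncomputable instance instModuleUAW [NotRootOfUnity q] (V : Type*) [AddCommGroup V]
    [Module (H q) V] : Module (UAW q) V :=
  Module.compHom V (zeta q : UAW q →+* H q)

/-- The eigenspace `V(θ) = {v | t_0 v = θ v}`, as a `△_q`-submodule of `V`. -/
noncomputable def eigen (q : F) [NotRootOfUnity q] (V : Type*) [AddCommGroup V] [Module F V]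
    [Module (H q) V] [IsScalarTower F (H q) V] (θ : F) : Submodule (UAW q) V where
  carrier := {v | H.t q 0 • v = θ • v}
  zero_mem' := by simp
  add_mem' := by
    intro a b ha hb
    simp only [Set.mem_ofPred_eq] at *
    rw [smul_add, smul_add, ha, hb]
  smul_mem' := by
    intro x v hv
    simp only [Set.mem_ofPred_eq] at *
    change H.t q 0 • (zeta q x • v) = θ • (zeta q x • v)
    rw [← mul_smul, zeta_t0, mul_smul, hv]
    rw [← algebraMap_smul (H q) θ v, ← algebraMap_smul (H q) θ, ← mul_smul, ← mul_smul,
      Algebra.commutes]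

end Modules

/-! ### The module `E(k₀, k₁, k₂, k₃)` -/

/-- The conditions on the parameters of `E(k₀, k₁, k₂, k₃)`: `d` is odd, the `k_i` are nonzero and
`k₀² = q^{-d-1}`. -/
structure Admissible {F : Type*} [Field F] (q : F) (d : ℕ) (k0 k1 k2 k3 : F) : Prop where
  odd : Odd d
  ne0 : k0 ≠ 0
  ne1 : k1 ≠ 0
  ne2 : k2 ≠ 0
  ne3 : k3 ≠ 0
  sq : k0 ^ 2 = q ^ (-(d : ℤ) - 1)

section ModuleE

variable {F : Type*} [Field F]

/-- The standard basis vector `v_i` of `F^{d+1}` for `0 ≤ i ≤ d` (and `0` for `i > d`). -/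
def vec (F : Type*) [Field F] (d i : ℕ) : Fin (d + 1) → F :=
  if h : i < d + 1 then Pi.single ⟨i, h⟩ 1 else 0

/-- The vector `t_0 v_i`. -/
def act0 (q : F) (d : ℕ) (k0 : F) (i : ℕ) : Fin (d + 1) → F :=
  if i = 0 then k0 • vec F d 0
  else if i = d then k0 • vec F d d
  else if Even i then
    (k0⁻¹ * q⁻¹ ^ i * (1 - q ^ i) * (1 - k0 ^ 2 * q ^ i)) • vec F d (i - 1) +
      (k0 + k0⁻¹ - k0⁻¹ * q⁻¹ ^ i) • vec F d i
  else (k0⁻¹ * q⁻¹ ^ (i + 1)) • (vec F d i - vec F d (i + 1))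

/-- The vector `t_1 v_i`. -/
def act1 (q : F) (d : ℕ) (k0 k1 : F) (i : ℕ) : Fin (d + 1) → F :=
  if i = 0 then k1 • vec F d 0 + k1⁻¹ • vec F d 1
  else if Even i then
    (-k1 * (1 - q ^ i) * (1 - k0 ^ 2 * q ^ i)) • vec F d (i - 1) + k1 • vec F d i +
      k1⁻¹ • vec F d (i + 1)
  else k1⁻¹ • vec F d i

/-- The vector `t_2 v_i`. -/
def act2 (q : F) (d : ℕ) (k0 k1 k2 k3 : F) (i : ℕ) : Fin (d + 1) → F :=
  if Even i then
    (k0⁻¹ * k1⁻¹ * k3⁻¹ * q⁻¹ ^ (i + 1)) • (vec F d i - vec F d (i + 1))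
  else
    ((k0 * k1 * k3 * q ^ i - k2) * (k0 * k1 * k3 * q ^ i - k2⁻¹) / (k0 * k1 * k3 * q ^ i)) •
        vec F d (i - 1) +
      (k2 + k2⁻¹ - k0⁻¹ * k1⁻¹ * k3⁻¹ * q⁻¹ ^ i) • vec F d i

/-- The vector `t_3 v_i`. -/
def act3 (q : F) (d : ℕ) (k0 k1 k2 k3 : F) (i : ℕ) : Fin (d + 1) → F :=
  if Even i then k3 • vec F d i
  else if i = d then
    (-k3⁻¹ * (k0 * k1 * k3 * q ^ d - k2) * (k0 * k1 * k3 * q ^ d - k2⁻¹)) • vec F d (d - 1) +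
      k3⁻¹ • vec F d d
  else
    (-k3⁻¹ * (k0 * k1 * k3 * q ^ i - k2) * (k0 * k1 * k3 * q ^ i - k2⁻¹)) • vec F d (i - 1) +
      k3⁻¹ • vec F d i + k3 • vec F d (i + 1)

/-- The linear endomorphism of `F^{d+1}` sending `v_i` to `f i` for `0 ≤ i ≤ d`. -/
noncomputable def ofBasis (d : ℕ) (f : ℕ → Fin (d + 1) → F) : Module.End F (Fin (d + 1) → F) :=
  (Pi.basisFun F (Fin (d + 1))).constr F (fun i => f i)

/-- The operators of `t_0, t_1, t_2, t_3` on `F^{d+1}`. -/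
noncomputable def opE (q : F) (d : ℕ) (k0 k1 k2 k3 : F) (i : ZMod 4) :
    Module.End F (Fin (d + 1) → F) :=
  if i = 0 then ofBasis d (act0 q d k0)
  else if i = 1 then ofBasis d (act1 q d k0 k1)
  else if i = 2 then ofBasis d (act2 q d k0 k1 k2 k3)
  else ofBasis d (act3 q d k0 k1 k2 k3)

/-- The parameter `k_i`. -/
def kE (k0 k1 k2 k3 : F) (i : ZMod 4) : F :=
  if i = 0 then k0 else if i = 1 then k1 else if i = 2 then k2 else k3

theorem ofBasis_vec (d : ℕ) (f : ℕ → Fin (d + 1) → F) {i : ℕ} (hi : i ≤ d) :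
    ofBasis d f (vec F d i) = f i := by
  have h : i < d + 1 := by omega
  have e : vec F d i = Pi.basisFun F (Fin (d + 1)) ⟨i, h⟩ := by simp [vec, h]
  rw [e, ofBasis, Module.Basis.constr_basis]

theorem vec_of_lt {d i : ℕ} (h : d < i) : vec F d i = 0 := by
  simp [vec, show ¬ i < d + 1 by omega]

theorem ext_vec {d : ℕ} {f g : Module.End F (Fin (d + 1) → F)}
    (h0 : f (vec F d 0) = g (vec F d 0))
    (h1 : ∀ m, f (vec F d (2 * m + 1)) = g (vec F d (2 * m + 1)))
    (h2 : ∀ m, f (vec F d (2 * m + 2)) = g (vec F d (2 * m + 2))) : f = g := by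
  refine (Pi.basisFun F (Fin (d + 1))).ext fun i => ?_
  have e : Pi.basisFun F (Fin (d + 1)) i = vec F d i := by
    simp [vec, Nat.le_of_lt_succ i.2]
  rw [e]
  obtain ⟨i, hi⟩ := i
  rcases Nat.even_or_odd' i with ⟨m, rfl | rfl⟩
  · cases m with
    | zero => exact h0
    | succ m => exact h2 m
  · exact h1 m

section Formulas

variable {q : F} {d : ℕ} {k0 k1 k2 k3 : F}

theorem Admissible.sq' (h : Admissible q d k0 k1 k2 k3) : k0 ^ 2 = (q ^ (d + 1))⁻¹ := by
  rw [h.sq, show -(d : ℤ) - 1 = -((d + 1 : ℕ) : ℤ) by push_cast; ring, zpow_neg, zpow_natCast]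

theorem Admissible.coef (hq : q ≠ 0) (h : Admissible q d k0 k1 k2 k3) {m : ℕ}
    (hm : d = 2 * m + 1) : 1 - k0 ^ 2 * q ^ (2 * m + 2) = 0 := by
  rw [h.sq', hm, show 2 * m + 1 + 1 = 2 * m + 2 by ring, inv_mul_cancel₀ (pow_ne_zero _ hq),
    sub_self]

theorem T0_zero : ofBasis d (act0 q d k0) (vec F d 0) = k0 • vec F d 0 := by
  rw [ofBasis_vec d _ (Nat.zero_le d)]; simp [act0]

theorem T0_odd (hq : q ≠ 0) (h : Admissible q d k0 k1 k2 k3) (m : ℕ) :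
    ofBasis d (act0 q d k0) (vec F d (2 * m + 1)) =
      (k0⁻¹ * q⁻¹ ^ (2 * m + 2)) • (vec F d (2 * m + 1) - vec F d (2 * m + 2)) := by
  by_cases hd : 2 * m + 1 ≤ d
  · rw [ofBasis_vec d _ hd, act0]
    by_cases he : 2 * m + 1 = d
    · have hs := h.coef hq he.symm
      have hk := h.ne0
      rw [if_neg (by omega), if_pos he, vec_of_lt (i := 2 * m + 2) (by omega), sub_zero, ← he]
      congr 1
      rw [inv_pow]
      field_simp
      linear_combination (-1 : F) * hs
    · rw [if_neg (by omega), if_neg he, if_neg (by simp)]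
  · rw [vec_of_lt (by omega), vec_of_lt (by omega)]; simp

theorem T0_even (hq : q ≠ 0) (h : Admissible q d k0 k1 k2 k3) (m : ℕ) :
    ofBasis d (act0 q d k0) (vec F d (2 * m + 2)) =
      (k0⁻¹ * q⁻¹ ^ (2 * m + 2) * (1 - q ^ (2 * m + 2)) * (1 - k0 ^ 2 * q ^ (2 * m + 2))) •
        vec F d (2 * m + 1) +
      (k0 + k0⁻¹ - k0⁻¹ * q⁻¹ ^ (2 * m + 2)) • vec F d (2 * m + 2) := by
  by_cases hd : 2 * m + 2 ≤ d
  · obtain ⟨n, hn⟩ := h.odd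
    rw [ofBasis_vec d _ hd, act0, if_neg (by omega), if_neg (by omega),
      if_pos (by simp [Nat.even_add])]
    rfl
  · rw [vec_of_lt (i := 2 * m + 2) (by omega)]
    by_cases he : d = 2 * m + 1
    · rw [h.coef hq he]; simp
    · rw [vec_of_lt (by omega)]; simp

theorem T1_zero : ofBasis d (act1 q d k0 k1) (vec F d 0) =
    k1 • vec F d 0 + k1⁻¹ • vec F d 1 := by
  rw [ofBasis_vec d _ (Nat.zero_le d)]; simp [act1]

theorem T1_odd (m : ℕ) : ofBasis d (act1 q d k0 k1) (vec F d (2 * m + 1)) =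
    k1⁻¹ • vec F d (2 * m + 1) := by
  by_cases hd : 2 * m + 1 ≤ d
  · rw [ofBasis_vec d _ hd, act1, if_neg (by omega), if_neg (by simp)]
  · rw [vec_of_lt (by omega)]; simp

theorem T1_even (hq : q ≠ 0) (h : Admissible q d k0 k1 k2 k3) (m : ℕ) :
    ofBasis d (act1 q d k0 k1) (vec F d (2 * m + 2)) =
      (-k1 * (1 - q ^ (2 * m + 2)) * (1 - k0 ^ 2 * q ^ (2 * m + 2))) • vec F d (2 * m + 1) +
      k1 • vec F d (2 * m + 2) + k1⁻¹ • vec F d (2 * m + 3) := by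
  by_cases hd : 2 * m + 2 ≤ d
  · rw [ofBasis_vec d _ hd, act1, if_neg (by omega), if_pos (by simp [Nat.even_add])]
    rfl
  · rw [vec_of_lt (i := 2 * m + 2) (by omega), vec_of_lt (i := 2 * m + 3) (by omega)]
    by_cases he : d = 2 * m + 1
    · rw [h.coef hq he]; simp
    · rw [vec_of_lt (by omega)]; simp

theorem T2_even (m : ℕ) : ofBasis d (act2 q d k0 k1 k2 k3) (vec F d (2 * m)) =
    (k0⁻¹ * k1⁻¹ * k3⁻¹ * q⁻¹ ^ (2 * m + 1)) • (vec F d (2 * m) - vec F d (2 * m + 1)) := by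
  by_cases hd : 2 * m ≤ d
  · rw [ofBasis_vec d _ hd, act2, if_pos (by simp)]
  · rw [vec_of_lt (by omega), vec_of_lt (by omega)]; simp

theorem T2_odd (h : Admissible q d k0 k1 k2 k3) (m : ℕ) :
    ofBasis d (act2 q d k0 k1 k2 k3) (vec F d (2 * m + 1)) =
    ((k0 * k1 * k3 * q ^ (2 * m + 1) - k2) * (k0 * k1 * k3 * q ^ (2 * m + 1) - k2⁻¹) /
      (k0 * k1 * k3 * q ^ (2 * m + 1))) • vec F d (2 * m) +
      (k2 + k2⁻¹ - k0⁻¹ * k1⁻¹ * k3⁻¹ * q⁻¹ ^ (2 * m + 1)) • vec F d (2 * m + 1) := by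
  by_cases hd : 2 * m + 1 ≤ d
  · rw [ofBasis_vec d _ hd, act2, if_neg (by simp)]
    rfl
  · obtain ⟨n, hn⟩ := h.odd
    rw [vec_of_lt (by omega), vec_of_lt (by omega)]; simp

theorem T3_even (m : ℕ) : ofBasis d (act3 q d k0 k1 k2 k3) (vec F d (2 * m)) =
    k3 • vec F d (2 * m) := by
  by_cases hd : 2 * m ≤ d
  · rw [ofBasis_vec d _ hd, act3, if_pos (by simp)]
  · rw [vec_of_lt (by omega)]; simp

theorem T3_odd (h : Admissible q d k0 k1 k2 k3) (m : ℕ) :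
    ofBasis d (act3 q d k0 k1 k2 k3) (vec F d (2 * m + 1)) =
    (-k3⁻¹ * (k0 * k1 * k3 * q ^ (2 * m + 1) - k2) * (k0 * k1 * k3 * q ^ (2 * m + 1) - k2⁻¹)) •
      vec F d (2 * m) + k3⁻¹ • vec F d (2 * m + 1) + k3 • vec F d (2 * m + 2) := by
  by_cases hd : 2 * m + 1 ≤ d
  · rw [ofBasis_vec d _ hd, act3, if_neg (by simp)]
    by_cases he : 2 * m + 1 = d
    · rw [if_pos he, vec_of_lt (i := 2 * m + 2) (by omega), smul_zero, add_zero]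
      subst he
      rfl
    · rw [if_neg he]
      rfl
  · obtain ⟨n, hn⟩ := h.odd
    rw [vec_of_lt (by omega), vec_of_lt (by omega), vec_of_lt (by omega)]; simp

theorem T0_sq (hq : q ≠ 0) (h : Admissible q d k0 k1 k2 k3) :
    ofBasis d (act0 q d k0) * ofBasis d (act0 q d k0) =
      (k0 + k0⁻¹) • ofBasis d (act0 q d k0) - 1 := by
  have n0 := h.ne0
  refine ext_vec ?_ (fun m => ?_) (fun m => ?_)
  · simp only [Module.End.mul_apply, LinearMap.sub_apply, LinearMap.smul_apply,
      Module.End.one_apply, map_smul, T0_zero]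
    match_scalars
    field_simp
    ring
  · simp only [Module.End.mul_apply, LinearMap.sub_apply, LinearMap.smul_apply,
      Module.End.one_apply, map_smul, map_sub, T0_odd hq h, T0_even hq h]
    generalize hQ : q ^ (2 * m + 2) = Q
    have : Q ≠ 0 := hQ ▸ pow_ne_zero _ hq
    simp only [inv_pow, hQ]
    match_scalars <;> field_simp <;> ring
  · simp only [Module.End.mul_apply, LinearMap.sub_apply, LinearMap.smul_apply,
      Module.End.one_apply, map_smul, map_add, T0_odd hq h, T0_even hq h]
    generalize hQ : q ^ (2 * m + 2) = Q
    have : Q ≠ 0 := hQ ▸ pow_ne_zero _ hq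
    simp only [inv_pow, hQ]
    match_scalars <;> field_simp <;> ring

theorem T1_sq (hq : q ≠ 0) (h : Admissible q d k0 k1 k2 k3) :
    ofBasis d (act1 q d k0 k1) * ofBasis d (act1 q d k0 k1) =
      (k1 + k1⁻¹) • ofBasis d (act1 q d k0 k1) - 1 := by
  have n1 := h.ne1
  have T1_one : ofBasis d (act1 q d k0 k1) (vec F d 1) = k1⁻¹ • vec F d 1 := T1_odd 0
  have T1_three (m : ℕ) : ofBasis d (act1 q d k0 k1) (vec F d (2 * m + 3)) =
    k1⁻¹ • vec F d (2 * m + 3) := T1_odd (m + 1)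
  refine ext_vec ?_ (fun m => ?_) (fun m => ?_)
  · simp only [Module.End.mul_apply, LinearMap.sub_apply, LinearMap.smul_apply,
      Module.End.one_apply, map_smul, map_add, T1_zero, T1_one]
    match_scalars <;> field_simp <;> ring
  · simp only [Module.End.mul_apply, LinearMap.sub_apply, LinearMap.smul_apply,
      Module.End.one_apply, map_smul, T1_odd]
    match_scalars <;> field_simp <;> ring
  · simp only [Module.End.mul_apply, LinearMap.sub_apply, LinearMap.smul_apply,
      Module.End.one_apply, map_smul, map_add, T1_odd, T1_three, T1_even hq h]
    match_scalars <;> field_simp <;> ring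

theorem T2_sq (hq : q ≠ 0) (h : Admissible q d k0 k1 k2 k3) :
    ofBasis d (act2 q d k0 k1 k2 k3) * ofBasis d (act2 q d k0 k1 k2 k3) =
      (k2 + k2⁻¹) • ofBasis d (act2 q d k0 k1 k2 k3) - 1 := by
  have n0 := h.ne0
  have n1 := h.ne1
  have n2 := h.ne2
  have n3 := h.ne3
  have ev (m : ℕ) : (ofBasis d (act2 q d k0 k1 k2 k3) * ofBasis d (act2 q d k0 k1 k2 k3))
      (vec F d (2 * m)) =
      ((k2 + k2⁻¹) • ofBasis d (act2 q d k0 k1 k2 k3) - 1) (vec F d (2 * m)) := by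
    simp only [Module.End.mul_apply, LinearMap.sub_apply, LinearMap.smul_apply,
      Module.End.one_apply, map_smul, map_sub, T2_even, T2_odd h]
    generalize hQ : q ^ (2 * m + 1) = Q
    have : Q ≠ 0 := hQ ▸ pow_ne_zero _ hq
    simp only [inv_pow, hQ]
    match_scalars <;> field_simp <;> ring
  refine ext_vec (ev 0) (fun m => ?_) (fun m => ev (m + 1))
  simp only [Module.End.mul_apply, LinearMap.sub_apply, LinearMap.smul_apply,
    Module.End.one_apply, map_smul, map_add, T2_even, T2_odd h]
  generalize hQ : q ^ (2 * m + 1) = Q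
  have : Q ≠ 0 := hQ ▸ pow_ne_zero _ hq
  simp only [inv_pow, hQ]
  match_scalars <;> field_simp <;> ring

theorem T3_sq (h : Admissible q d k0 k1 k2 k3) :
    ofBasis d (act3 q d k0 k1 k2 k3) * ofBasis d (act3 q d k0 k1 k2 k3) =
      (k3 + k3⁻¹) • ofBasis d (act3 q d k0 k1 k2 k3) - 1 := by
  have n2 := h.ne2
  have n3 := h.ne3
  have ev (m : ℕ) : (ofBasis d (act3 q d k0 k1 k2 k3) * ofBasis d (act3 q d k0 k1 k2 k3))
      (vec F d (2 * m)) =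
      ((k3 + k3⁻¹) • ofBasis d (act3 q d k0 k1 k2 k3) - 1) (vec F d (2 * m)) := by
    simp only [Module.End.mul_apply, LinearMap.sub_apply, LinearMap.smul_apply,
      Module.End.one_apply, map_smul, T3_even]
    match_scalars <;> field_simp <;> ring
  have T3_two (m : ℕ) : ofBasis d (act3 q d k0 k1 k2 k3) (vec F d (2 * m + 2)) =
    k3 • vec F d (2 * m + 2) := T3_even (m + 1)
  refine ext_vec (ev 0) (fun m => ?_) (fun m => ev (m + 1))
  simp only [Module.End.mul_apply, LinearMap.sub_apply, LinearMap.smul_apply,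
    Module.End.one_apply, map_smul, map_add, T3_even, T3_two, T3_odd h]
  match_scalars <;> field_simp <;> ring

theorem T_prod (hq : q ≠ 0) (h : Admissible q d k0 k1 k2 k3) :
    ofBasis d (act0 q d k0) * ofBasis d (act1 q d k0 k1) *
      ofBasis d (act2 q d k0 k1 k2 k3) * ofBasis d (act3 q d k0 k1 k2 k3) =
    q⁻¹ • 1 := by
  have n0 := h.ne0
  have n1 := h.ne1
  have n2 := h.ne2
  have n3 := h.ne3
  have T3_two (m : ℕ) : ofBasis d (act3 q d k0 k1 k2 k3) (vec F d (2 * m + 2)) =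
    k3 • vec F d (2 * m + 2) := T3_even (m + 1)
  have T2_two (m : ℕ) : ofBasis d (act2 q d k0 k1 k2 k3) (vec F d (2 * m + 2)) =
    (k0⁻¹ * k1⁻¹ * k3⁻¹ * q⁻¹ ^ (2 * m + 3)) • (vec F d (2 * m + 2) - vec F d (2 * m + 3)) :=
    T2_even (m + 1)
  have T1_one : ofBasis d (act1 q d k0 k1) (vec F d 1) = k1⁻¹ • vec F d 1 := T1_odd 0
  have T1_three (m : ℕ) : ofBasis d (act1 q d k0 k1) (vec F d (2 * m + 3)) =
    k1⁻¹ • vec F d (2 * m + 3) := T1_odd (m + 1)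
  have P0 : (ofBasis d (act0 q d k0) * ofBasis d (act1 q d k0 k1) *
      ofBasis d (act2 q d k0 k1 k2 k3)) (vec F d 0) = (q⁻¹ * k3⁻¹) • vec F d 0 := by
    have e := T2_even (q := q) (d := d) (k0 := k0) (k1 := k1) (k2 := k2) (k3 := k3) 0
    simp only [mul_zero, zero_add, pow_one] at e
    simp only [Module.End.mul_apply, map_smul, map_sub, map_add, e, T1_zero, T1_one, T0_zero]
    match_scalars <;> field_simp <;> ring
  have P2 (m : ℕ) : (ofBasis d (act0 q d k0) * ofBasis d (act1 q d k0 k1) *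
      ofBasis d (act2 q d k0 k1 k2 k3)) (vec F d (2 * m + 2)) =
      (q⁻¹ * k3⁻¹) • vec F d (2 * m + 2) := by
    simp only [Module.End.mul_apply, map_smul, map_sub, map_add, T2_two, T1_even hq h, T1_three,
      T0_even hq h, T0_odd hq h]
    rw [show 2 * m + 3 = 2 * m + 2 + 1 from rfl, pow_succ q⁻¹ (2 * m + 2)]
    generalize hQ : q ^ (2 * m + 2) = Q
    have : Q ≠ 0 := hQ ▸ pow_ne_zero _ hq
    simp only [inv_pow, hQ]
    match_scalars <;> field_simp <;> ring
  have P1 (m : ℕ) : (ofBasis d (act0 q d k0) * ofBasis d (act1 q d k0 k1) *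
      ofBasis d (act2 q d k0 k1 k2 k3)) (vec F d (2 * m + 1)) =
      (q⁻¹) • ((k3 + k3⁻¹) • vec F d (2 * m + 1) -
        ofBasis d (act3 q d k0 k1 k2 k3) (vec F d (2 * m + 1))) := by
    rw [T3_odd h]
    simp only [Module.End.mul_apply, map_smul, map_add, T2_odd h, T1_odd, T0_odd hq h]
    cases m with
    | zero =>
      simp only [mul_zero, zero_add, T1_zero, map_add, map_smul, T0_zero]
      have e := T0_odd hq h 0
      simp only [mul_zero, zero_add] at e
      rw [e]
      match_scalars <;> field_simp <;> ring
    | succ m =>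
      rw [show 2 * (m + 1) = 2 * m + 2 by ring]
      simp only [T1_even hq h, map_add, map_smul, T0_even hq h, T0_odd hq h]
      have e : ofBasis d (act0 q d k0) (vec F d (2 * m + 3)) = _ := T0_odd hq h (m + 1)
      rw [show 2 * (m + 1) = 2 * m + 2 by ring] at e
      rw [e]
      rw [show 2 * m + 2 + 2 = 2 * m + 2 + 1 + 1 from rfl, pow_succ q⁻¹ (2 * m + 2 + 1),
        pow_succ q⁻¹ (2 * m + 2), pow_succ q (2 * m + 2)]
      generalize hQ : q ^ (2 * m + 2) = Q
      have : Q ≠ 0 := hQ ▸ pow_ne_zero _ hq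
      simp only [inv_pow, hQ]
      match_scalars <;> field_simp <;> ring
  have P : ofBasis d (act0 q d k0) * ofBasis d (act1 q d k0 k1) *
      ofBasis d (act2 q d k0 k1 k2 k3) =
      q⁻¹ • ((k3 + k3⁻¹) • 1 - ofBasis d (act3 q d k0 k1 k2 k3)) := by
    refine ext_vec ?_ (fun m => ?_) (fun m => ?_)
    · rw [P0]
      have e := T3_even (q := q) (d := d) (k0 := k0) (k1 := k1) (k2 := k2) (k3 := k3) 0
      simp only [mul_zero] at e
      simp only [LinearMap.sub_apply, LinearMap.smul_apply, Module.End.one_apply, e]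
      module
    · rw [P1]; rfl
    · rw [P2]
      simp only [LinearMap.sub_apply, LinearMap.smul_apply, Module.End.one_apply, T3_two]
      module
  rw [P, smul_mul_assoc, sub_mul, T3_sq h, smul_mul_assoc, one_mul, sub_sub_cancel]

theorem opE_sq (hq : q ≠ 0) (h : Admissible q d k0 k1 k2 k3) (i : ZMod 4) :
    opE q d k0 k1 k2 k3 i * opE q d k0 k1 k2 k3 i =
      (kE k0 k1 k2 k3 i + (kE k0 k1 k2 k3 i)⁻¹) • opE q d k0 k1 k2 k3 i - 1 := by
  unfold opE kE
  split_ifs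
  · exact T0_sq hq h
  · exact T1_sq hq h
  · exact T2_sq hq h
  · exact T3_sq h

end Formulas

/-- The representation of `𝔥_q` on `F^{d+1}`: `t_i` acts as the operator above and `t_i⁻¹` as
`(k_i + k_i⁻¹) - t_i`. -/
noncomputable def repE {q : F} [hq : NotRootOfUnity q] {d : ℕ} {k0 k1 k2 k3 : F}
    (h : Admissible q d k0 k1 k2 k3) : H q →ₐ[F] Module.End F (Fin (d + 1) → F) :=
  H.lift q (opE q d k0 k1 k2 k3)
    (fun i => (kE k0 k1 k2 k3 i + (kE k0 k1 k2 k3 i)⁻¹) • 1 - opE q d k0 k1 k2 k3 i)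
    (fun i => by
      rw [mul_sub, opE_sq hq.ne_zero h, mul_smul_comm, mul_one, sub_sub_cancel])
    (fun i => by
      rw [sub_mul, opE_sq hq.ne_zero h, smul_mul_assoc, one_mul, sub_sub_cancel])
    (fun i x => by
      rw [add_sub_cancel, smul_mul_assoc, mul_smul_comm, one_mul, mul_one])
    (by
      rw [Algebra.algebraMap_eq_smul_one]
      exact T_prod hq.ne_zero h)

/-- The `(d+1)`-dimensional `𝔥_q`-module `E(k₀, k₁, k₂, k₃)`, with underlying space `F^{d+1}`. -/
def E {q : F} {d : ℕ} {k0 k1 k2 k3 : F} (_h : Admissible q d k0 k1 k2 k3) : Type _ :=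
  Fin (d + 1) → F

variable {q : F} {d : ℕ} {k0 k1 k2 k3 : F} (h : Admissible q d k0 k1 k2 k3)

instance : AddCommGroup (E h) := inferInstanceAs (AddCommGroup (Fin (d + 1) → F))

instance : Module F (E h) := inferInstanceAs (Module F (Fin (d + 1) → F))

noncomputable instance [NotRootOfUnity q] : Module (H q) (E h) :=
  Module.compHom (Fin (d + 1) → F)
    (repE h : H q →+* Module.End F (Fin (d + 1) → F))

instance [NotRootOfUnity q] : IsScalarTower F (H q) (E h) where
  smul_assoc a x v := by
    have e : ∀ w : Fin (d + 1) → F, repE h (a • x) w = a • repE h x w := fun w => by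
      rw [map_smul, LinearMap.smul_apply]
    exact e v

/-- The twisted module `E(k₀, k₁, k₂, k₃)^{1 mod 4}`. -/
abbrev E1 : Type _ := Twist (H.shift q 1) (E h)

end ModuleE

end DAHA

/-!
Put `N_k = t₀ - k`, a `△_q`-endomorphism of `V` with kernel `V(k)`. A nonzero `△_q`-submodule `W` of
`V(k)` generates the `𝔥_q`-module `t₀W + t₁W + t₂W + t₃W`, which `N_{k⁻¹}` maps into `W`; so
irreducibility of `V` makes `V(k) = N_{k⁻¹}V` both an atom and a coatom. Any further proper
submodule `W ≠ 0` is a common complement of `V(k)` and `V(k⁻¹)`. Then `N_{k⁻¹}` restricts to an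
isomorphism `W ≃ V(k)`, and its inverse, extended by zero on `W`, is a map `s` with
`N_{k⁻¹}s + sN_k = 1`. Inserting this identity in the trace of `t_i` gives
`tr t_i = (t_i + t_i⁻¹) · dim V / 2` for `i ≠ 0`. On `E¹` this fails for `t₃`, whose trace differs
from the predicted one by `k₀ - k₀⁻¹ ≠ 0`.
-/

namespace DAHA

section LinearAlgebra

theorem eq_bot_or_eq_or_isCompl_or_eq_top {α : Type*} [Lattice α] [BoundedOrder α] {a : α}
    (ha : IsAtom a) (ha' : IsCoatom a) (x : α) : x = ⊥ ∨ x = a ∨ IsCompl a x ∨ x = ⊤ := by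
  by_cases hax : a ≤ x
  · exact (ha'.le_iff.1 hax).elim (fun e => .inr (.inr (.inr e))) fun e => .inr (.inl e)
  · by_cases hxa : x ≤ a
    · exact (ha.le_iff.1 hxa).elim .inl fun e => .inr (.inl e)
    · exact .inr (.inr (.inl ⟨ha.not_le_iff_disjoint.1 hax, ha'.not_le_iff_codisjoint.1 hxa⟩))

open Submodule LinearMap

/-- For `s` take the inverse of the isomorphism `N' : W ≃ range N'`, extended by zero on `W`. -/
theorem exists_contracting_homotopy {R V : Type*} [Ring R] [AddCommGroup V] [Module R V]
    {N N' : Module.End R V} {W : Submodule R V} (hex : range N' = ker N)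
    (hW : IsCompl (range N') W) (hW' : IsCompl (ker N') W) (hsub : ∀ w ∈ W, N w - N' w ∈ W) :
    ∃ s : Module.End R V, projection _ _ hW * s = 0 ∧ s * projection _ _ hW = s ∧
      N' * s = projection _ _ hW ∧ N' * s + s * N = 1 := by
  set e := projection _ _ hW
  let φ : W ≃ₗ[R] range N' := kerComplementEquivRange N' hW'.symm
  let s : Module.End R V := W.subtype ∘ₗ φ.symm.toLinearMap ∘ₗ projectionOnto _ _ hW
  have hsN' {w : V} (hw : w ∈ W) : s (N' w) = w :=
    congrArg Subtype.val ((congrArg φ.symm (projectionOnto_apply_left hW (φ ⟨w, hw⟩))).trans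
      (φ.symm_apply_apply ⟨w, hw⟩))
  have hs_mem (x : V) : s x ∈ W := (φ.symm _).2
  have hs_zero {w : V} (hw : w ∈ W) : s w = 0 := by
    change ((φ.symm (projectionOnto _ _ hW w) : W) : V) = 0
    rw [projectionOnto_apply_of_mem_right hW hw, map_zero, coe_zero]
  have hN's : N' * s = e :=
    LinearMap.ext fun x => congrArg Subtype.val (φ.apply_symm_apply (projectionOnto _ _ hW x))
  refine ⟨s, LinearMap.ext fun x => projection_apply_of_mem_right hW (hs_mem x),
    LinearMap.ext fun x => congrArg (fun y => (φ.symm y : V)) (projectionOnto_apply_left hW _),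
    hN's, ?_⟩
  rw [hN's]
  ext x
  obtain ⟨y, hy, w, hw, rfl⟩ := mem_sup.1 (hW.sup_eq_top ▸ mem_top (x := x))
  have hNy : N y = 0 := mem_ker.1 (hex ▸ hy)
  have hsN : s (N w) = w := by
    rw [← sub_add_cancel (N w) (N' w), map_add, hs_zero (hsub w hw), hsN' hw, zero_add]
  change e (y + w) + s (N (y + w)) = y + w
  rw [map_add, map_add, map_add, hNy, map_zero, projection_apply_of_mem_left hW hy,
    projection_apply_of_mem_right hW hw, hsN, add_zero, zero_add]

variable {F V : Type*} [Field F] [AddCommGroup V] [Module F V]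

theorem trace_mul_eq_zero {e s P : Module.End F V} (hes : e * s = 0) (hse : s * e = s)
    (hP : Commute P e) : trace F V (P * s) = 0 := by
  rw [← hse, ← mul_assoc, LinearMap.trace_mul_comm, ← mul_assoc, ← hP.eq, mul_assoc, hes, mul_zero,
    map_zero]

theorem trace_eq_trace_mul_homotopy {N N' s : Module.End F V} (h : N' * s + s * N = 1)
    (T : Module.End F V) : trace F V T = trace F V ((N * T + T * N') * s) := by
  calc trace F V T = trace F V (T * N' * s) + trace F V (T * s * N) := by
        rw [← map_add, mul_assoc, mul_assoc, ← mul_add, h, mul_one]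
    _ = trace F V ((N * T + T * N') * s) := by
        rw [LinearMap.trace_mul_comm F (T * s), ← map_add, ← mul_assoc, ← add_mul, add_comm]

end LinearAlgebra

section Relations

variable {F : Type*} [Field F] (q : F)

theorem H.t_mul_t (i : ZMod 4) :
    H.t q i * H.t q (i + 1) = q⁻¹ • (H.tinv q (i + 3) * H.tinv q (i + 2)) := by
  have h := H.prod_shift q i
  rw [zero_add, add_comm 1, add_comm 2, add_comm 3] at h
  calc H.t q i * H.t q (i + 1)
      = H.t q i * H.t q (i + 1) * (H.t q (i + 2) * (H.t q (i + 3) * H.tinv q (i + 3)) *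
          H.tinv q (i + 2)) := by rw [H.t_mul_tinv, mul_one, H.t_mul_tinv, mul_one]
    _ = H.t q i * H.t q (i + 1) * H.t q (i + 2) * H.t q (i + 3) *
          (H.tinv q (i + 3) * H.tinv q (i + 2)) := by simp only [mul_assoc]
    _ = q⁻¹ • (H.tinv q (i + 3) * H.tinv q (i + 2)) := by rw [h, Algebra.smul_def]

theorem H.t_mul_t_mul_t (i : ZMod 4) :
    H.t q i * H.t q (i + 1) * H.t q (i + 2) = q⁻¹ • H.tinv q (i + 3) := by
  rw [H.t_mul_t, smul_mul_assoc, mul_assoc, H.tinv_mul_t, mul_one]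

theorem H.t_eq (i : ZMod 4) :
    H.t q i = q⁻¹ • (H.tinv q (i + 3) * H.tinv q (i + 2) * H.tinv q (i + 1)) := by
  rw [← smul_mul_assoc, ← H.t_mul_t, mul_assoc, H.t_mul_tinv, mul_one]

theorem H.pair_eq (i : ZMod 4) : H.pair q i = H.t q 0 * H.t q i + H.tinv q i * H.tinv q 0 :=
  (pair_symm (H.central q 0) (H.central q i)).symm

theorem H.pair_mem_range_zeta [NotRootOfUnity q] {i : ZMod 4} (hi : i ≠ 0) :
    ∃ x, zeta q x = H.pair q i := by
  fin_cases i
  · exact absurd rfl hi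
  exacts [⟨_, zeta_gen q .A⟩, ⟨_, zeta_gen q .C⟩, ⟨_, zeta_gen q .B⟩]

variable {q}

theorem H.smul_mem {V : Type*} [AddCommGroup V] [Module F V] [Module (H q) V]
    [IsScalarTower F (H q) V] {M : Submodule F V} (ht : ∀ i, ∀ v ∈ M, H.t q i • v ∈ M)
    (htinv : ∀ i, ∀ v ∈ M, H.tinv q i • v ∈ M) (x : H q) {v : V} (hv : v ∈ M) : x • v ∈ M := by
  obtain ⟨y, rfl⟩ := RingQuot.mkAlgHom_surjective F (HRel q) x
  let φ : FreeAlgebra F HGen →ₐ[F] H q := RingQuot.mkAlgHom F (HRel q)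
  change φ y • v ∈ M
  induction y using FreeAlgebra.induction generalizing v with
  | grade0 r =>
    rw [AlgHom.commutes, algebraMap_smul]
    exact M.smul_mem r hv
  | grade1 g =>
    cases g with
    | t i => exact ht i v hv
    | tinv i => exact htinv i v hv
  | mul a b ha hb =>
    rw [map_mul, mul_smul]
    exact ha (hb hv)
  | add a b ha hb =>
    rw [map_add, add_smul]
    exact M.add_mem (ha hv) (hb hv)

theorem eq_top_of_t_smul_mem {V : Type*} [AddCommGroup V] [Module F V] [Module (H q) V]
    [IsScalarTower F (H q) V] [IsSimpleModule (H q) V] {M : Submodule F V} (hM : M ≠ ⊥)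
    (ht : ∀ i, ∀ v ∈ M, H.t q i • v ∈ M) (htinv : ∀ i, ∀ v ∈ M, H.tinv q i • v ∈ M) : M = ⊤ := by
  let M' : Submodule (H q) V := { M with smul_mem' := fun x _ hv => H.smul_mem ht htinv x hv }
  refine SetLike.coe_injective (congrArg SetLike.coe ((eq_bot_or_eq_top M').resolve_left ?_) :)
  exact fun h => hM (SetLike.coe_injective (congrArg SetLike.coe h :))

end Relations

section Modules

variable {F : Type*} [Field F] {q : F} {V : Type*} [AddCommGroup V] [Module F V] [Module (H q) V]
  {c : ZMod 4 → F} {k k' : F}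

/-- On `V` the central elements `t_i + t_i⁻¹` act as the scalars `c i`. -/
def HasCentralCharacter (q : F) (V : Type*) [AddCommGroup V] [Module F V] [Module (H q) V]
    (c : ZMod 4 → F) : Prop :=
  ∀ (i : ZMod 4) (v : V), H.t q i • v + H.tinv q i • v = c i • v

theorem HasCentralCharacter.tinv_smul (hV : HasCentralCharacter q V c) (i : ZMod 4) (v : V) :
    H.tinv q i • v = c i • v - H.t q i • v :=
  eq_sub_of_add_eq' (hV i v)

theorem HasCentralCharacter.tinv_smul_mem_iff (hV : HasCentralCharacter q V c) {M : Submodule F V}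
    {v : V} (hv : v ∈ M) (i : ZMod 4) : H.tinv q i • v ∈ M ↔ H.t q i • v ∈ M := by
  rw [hV.tinv_smul]
  exact M.sub_mem_iff_right (M.smul_mem _ hv)

theorem HasCentralCharacter.tinv_smul_tinv_smul_mem_iff [IsScalarTower F (H q) V]
    (hV : HasCentralCharacter q V c) {M : Submodule F V} {w : V} (hw : w ∈ M)
    (hM : ∀ i, H.t q i • w ∈ M) (i j : ZMod 4) :
    H.tinv q i • H.tinv q j • w ∈ M ↔ H.t q i • H.t q j • w ∈ M := by
  rw [hV.tinv_smul_mem_iff ((hV.tinv_smul_mem_iff hw j).2 (hM j)), hV.tinv_smul j, smul_sub,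
    smul_comm]
  exact M.sub_mem_iff_right (M.smul_mem _ (hM i))

variable [NotRootOfUnity q]

/-- The subspace `t₀W + t₁W + t₂W + t₃W`; for `W ≤ V(k)` it is the `𝔥_q`-module generated
by `W`. -/
def tSpan (W : Submodule (UAW q) V) : Submodule F V :=
  Submodule.span F {v | ∃ i, ∃ w ∈ W, H.t q i • w = v}

theorem t_smul_mem_tSpan {W : Submodule (UAW q) V} (i : ZMod 4) {w : V} (hw : w ∈ W) :
    H.t q i • w ∈ tSpan W :=
  Submodule.subset_span ⟨i, w, hw, rfl⟩

theorem pair_smul_mem {V : Type*} [AddCommGroup V] [Module (H q) V]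
    (W : Submodule (UAW q) V) {i : ZMod 4} (hi : i ≠ 0) {w : V} (hw : w ∈ W) :
    H.pair q i • w ∈ W := by
  obtain ⟨x, hx⟩ := H.pair_mem_range_zeta q hi
  exact hx ▸ W.smul_mem x hw

variable [IsScalarTower F (H q) V]

theorem HasCentralCharacter.t_smul_t_add_one_smul_mem_iff (hV : HasCentralCharacter q V c)
    {M : Submodule F V} {w : V} (hw : w ∈ M) (hM : ∀ i, H.t q i • w ∈ M) (i : ZMod 4) :
    H.t q i • H.t q (i + 1) • w ∈ M ↔ H.t q (i + 3) • H.t q (i + 2) • w ∈ M := by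
  rw [← hV.tinv_smul_tinv_smul_mem_iff hw hM (i + 3), ← mul_smul, H.t_mul_t, smul_assoc, mul_smul,
    M.smul_mem_iff (inv_ne_zero NotRootOfUnity.ne_zero)]

instance : IsScalarTower F (UAW q) V where
  smul_assoc a x v := by
    change zeta q (a • x) • v = a • zeta q x • v
    rw [map_smul, smul_assoc]

/-- The operator `N_k = t₀ - k`. It is `△_q`-linear because `t₀` commutes with the image of `ζ`. -/
noncomputable def t0Sub (q : F) [NotRootOfUnity q] (V : Type*) [AddCommGroup V] [Module F V]
    [Module (H q) V] [IsScalarTower F (H q) V] (k : F) : Module.End (UAW q) V where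
  toFun v := H.t q 0 • v - k • v
  map_add' v w := by rw [smul_add, smul_add, add_sub_add_comm]
  map_smul' x v := by
    have h : H.t q 0 • zeta q x • v = zeta q x • H.t q 0 • v := by
      rw [← mul_smul, zeta_t0, mul_smul]
    change H.t q 0 • zeta q x • v - k • zeta q x • v = zeta q x • (H.t q 0 • v - k • v)
    rw [h, smul_sub, smul_comm k]

theorem t0Sub_apply (k : F) (v : V) : t0Sub q V k v = H.t q 0 • v - k • v := rfl

theorem mem_eigen {k : F} {v : V} : v ∈ eigen q V k ↔ H.t q 0 • v = k • v := Iff.rfl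

theorem ker_t0Sub (k : F) : LinearMap.ker (t0Sub q V k) = eigen q V k := by
  ext v
  rw [LinearMap.mem_ker, t0Sub_apply, sub_eq_zero, mem_eigen]

theorem HasCentralCharacter.tinv_zero_smul (hV : HasCentralCharacter q V c) (hc : c 0 = k + k')
    {w : V} (hw : w ∈ eigen q V k) : H.tinv q 0 • w = k' • w := by
  rw [hV.tinv_smul, mem_eigen.1 hw, hc, add_smul, add_sub_cancel_left]

theorem range_t0Sub_le_eigen (hV : HasCentralCharacter q V c) (hc : c 0 = k + k')
    (hk : k * k' = 1) : LinearMap.range (t0Sub q V k') ≤ eigen q V k := by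
  rintro _ ⟨v, rfl⟩
  have htt : H.t q 0 • H.t q 0 • v = c 0 • H.t q 0 • v - v := by
    rw [← hV 0, ← mul_smul (H.tinv q 0), H.tinv_mul_t, one_smul, add_sub_cancel_right]
  rw [mem_eigen, t0Sub_apply, smul_sub, smul_sub, htt, hc, smul_comm (H.t q 0),
    smul_smul k, hk, one_smul, add_smul]
  abel

theorem t0Sub_t_smul_mem (hV : HasCentralCharacter q V c) (hc : c 0 = k + k')
    {W : Submodule (UAW q) V} (hW : W ≤ eigen q V k) (i : ZMod 4) {w : V} (hw : w ∈ W) :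
    t0Sub q V k' (H.t q i • w) ∈ W := by
  by_cases hi : i = 0
  · rw [hi, mem_eigen.1 (hW hw)]
    exact (t0Sub q V k').map_smul_of_tower k w ▸ W.smul_of_tower_mem k (W.sub_mem
      ((mem_eigen.1 (hW hw)).symm ▸ W.smul_of_tower_mem k hw) (W.smul_of_tower_mem k' hw))
  · have h : t0Sub q V k' (H.t q i • w) = H.pair q i • w - (k' * c i) • w := by
      rw [H.pair_eq, add_smul, mul_smul, mul_smul, hV.tinv_zero_smul hc (hW hw), t0Sub_apply,
        smul_comm _ k', hV.tinv_smul, smul_sub, mul_smul]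
      abel
    exact h ▸ W.sub_mem (pair_smul_mem W hi hw) (W.smul_of_tower_mem _ hw)

theorem mem_tSpan {W : Submodule (UAW q) V} (hk : k ≠ 0) (hW : W ≤ eigen q V k) {w : V}
    (hw : w ∈ W) : w ∈ tSpan W := by
  have h := t_smul_mem_tSpan 0 hw
  rwa [mem_eigen.1 (hW hw), Submodule.smul_mem_iff _ hk] at h

theorem t_zero_smul (k : F) (v : V) : H.t q 0 • v = k • v + t0Sub q V k v := by
  rw [t0Sub_apply, add_sub_cancel]

theorem t_zero_smul_t_smul_mem_tSpan (hV : HasCentralCharacter q V c) (hc : c 0 = k + k')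
    (hk : k * k' = 1) {W : Submodule (UAW q) V} (hW : W ≤ eigen q V k) (i : ZMod 4) {w : V}
    (hw : w ∈ W) : H.t q 0 • H.t q i • w ∈ tSpan W := by
  rw [t_zero_smul k' (H.t q i • w)]
  exact (tSpan W).add_mem ((tSpan W).smul_mem _ (t_smul_mem_tSpan i hw))
    (mem_tSpan (left_ne_zero_of_mul_eq_one hk) hW (t0Sub_t_smul_mem hV hc hW i hw))

theorem t_three_smul_t_one_smul_mem_tSpan (hV : HasCentralCharacter q V c) (hc : c 0 = k + k')
    (hk : k * k' = 1) {W : Submodule (UAW q) V} (hW : W ≤ eigen q V k) {w : V} (hw : w ∈ W) :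
    H.t q 3 • H.t q 1 • w ∈ tSpan W := by
  have h : H.t q 3 • H.t q 0 • H.t q 1 • w = q⁻¹ • H.tinv q 2 • w := by
    rw [← mul_smul, ← mul_smul, ← smul_assoc]
    exact congrArg (· • w) (H.t_mul_t_mul_t q 3)
  rw [t_zero_smul k' (H.t q 1 • w), smul_add, smul_comm (H.t q 3), ← eq_sub_iff_add_eq] at h
  rw [← (tSpan W).smul_mem_iff (right_ne_zero_of_mul_eq_one hk), h]
  have hw' := mem_tSpan (left_ne_zero_of_mul_eq_one hk) hW hw
  have h_tinv : H.tinv q 2 • w ∈ tSpan W := (hV.tinv_smul_mem_iff hw' 2).2 (t_smul_mem_tSpan 2 hw)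
  exact (tSpan W).sub_mem ((tSpan W).smul_mem _ h_tinv)
    (t_smul_mem_tSpan 3 (t0Sub_t_smul_mem hV hc hW 1 hw))

theorem t_smul_t_smul_mem_tSpan (hV : HasCentralCharacter q V c) (hc : c 0 = k + k')
    (hk : k * k' = 1) {W : Submodule (UAW q) V} (hW : W ≤ eigen q V k) {i : ZMod 4} (hi : i ≠ 1)
    (j : ZMod 4) {w : V} (hw : w ∈ W) : H.t q i • H.t q j • w ∈ tSpan W := by
  have hw' := mem_tSpan (left_ne_zero_of_mul_eq_one hk) hW hw
  have hM (j) : H.t q j • w ∈ tSpan W := t_smul_mem_tSpan j hw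
  have h_zero (i) : H.t q i • H.t q 0 • w ∈ tSpan W :=
    t_smul_mem_tSpan i (hW hw ▸ W.smul_of_tower_mem k hw)
  have h_self (i) : H.t q i • H.t q i • w ∈ tSpan W := by
    rw [← hV.tinv_smul_mem_iff (hM i), ← mul_smul, H.tinv_mul_t, one_smul]
    exact hw'
  fin_cases i
  · exact t_zero_smul_t_smul_mem_tSpan hV hc hk hW j hw
  · exact absurd rfl hi
  · fin_cases j
    · exact h_zero 2
    · exact (hV.t_smul_t_add_one_smul_mem_iff hw' hM 3).1 (h_zero 3)
    · exact h_self 2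
    · exact (hV.t_smul_t_add_one_smul_mem_iff hw' hM 2).2 (h_zero 1)
  · fin_cases j
    · exact h_zero 3
    · exact t_three_smul_t_one_smul_mem_tSpan hV hc hk hW hw
    · exact (hV.t_smul_t_add_one_smul_mem_iff hw' hM 0).1
        (t_zero_smul_t_smul_mem_tSpan hV hc hk hW 1 hw)
    · exact h_self 3

theorem t_smul_mem_tSpan_of_mem (hV : HasCentralCharacter q V c) (hc : c 0 = k + k')
    (hk : k * k' = 1) {W : Submodule (UAW q) V} (hW : W ≤ eigen q V k) (i : ZMod 4) {v : V}
    (hv : v ∈ tSpan W) : H.t q i • v ∈ tSpan W := by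
  have ht {i} (hi : i ≠ 1) {v} (hv : v ∈ tSpan W) : H.t q i • v ∈ tSpan W := by
    induction hv using Submodule.span_induction with
    | mem _ hv =>
      obtain ⟨j, w, hw, rfl⟩ := hv
      exact t_smul_t_smul_mem_tSpan hV hc hk hW hi j hw
    | zero => exact (smul_zero (A := V) (H.t q i)).symm ▸ (tSpan W).zero_mem
    | add v v' _ _ hv hv' => exact smul_add (H.t q i) v v' ▸ (tSpan W).add_mem hv hv'
    | smul a v _ hv => exact smul_comm a (H.t q i) v ▸ (tSpan W).smul_mem a hv
  have htinv {i} (hi : i ≠ 1) {v} (hv : v ∈ tSpan W) : H.tinv q i • v ∈ tSpan W :=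
    (hV.tinv_smul_mem_iff hv i).2 (ht hi hv)
  by_cases hi : i = 1
  · rw [hi, H.t_eq, smul_assoc, mul_smul, mul_smul]
    exact (tSpan W).smul_mem _
      (htinv (i := 0) (by decide) (htinv (i := 3) (by decide) (htinv (i := 2) (by decide) hv)))
  · exact ht hi hv

theorem tSpan_eq_top [IsSimpleModule (H q) V] (hV : HasCentralCharacter q V c)
    (hc : c 0 = k + k') (hk : k * k' = 1) {W : Submodule (UAW q) V} (hW : W ≤ eigen q V k)
    (hW' : W ≠ ⊥) : tSpan W = ⊤ := by
  obtain ⟨w, hw, hw0⟩ := W.exists_mem_ne_zero_of_ne_bot hW'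
  have hbot : tSpan W ≠ ⊥ :=
    (Submodule.ne_bot_iff _).2 ⟨w, mem_tSpan (left_ne_zero_of_mul_eq_one hk) hW hw, hw0⟩
  exact eq_top_of_t_smul_mem hbot
    (fun i _ hv => t_smul_mem_tSpan_of_mem hV hc hk hW i hv)
    fun i _ hv => (hV.tinv_smul_mem_iff hv i).2 (t_smul_mem_tSpan_of_mem hV hc hk hW i hv)

theorem range_t0Sub_le [IsSimpleModule (H q) V] (hV : HasCentralCharacter q V c)
    (hc : c 0 = k + k') (hk : k * k' = 1) {W : Submodule (UAW q) V} (hW : W ≤ eigen q V k)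
    (hW' : W ≠ ⊥) : LinearMap.range (t0Sub q V k') ≤ W := by
  have h : tSpan W ≤ (W.comap (t0Sub q V k')).restrictScalars F := by
    refine Submodule.span_le.2 ?_
    rintro _ ⟨i, w, hw, rfl⟩
    exact t0Sub_t_smul_mem hV hc hW i hw
  rintro _ ⟨v, rfl⟩
  exact h (tSpan_eq_top hV hc hk hW hW' ▸ Submodule.mem_top)

theorem isAtom_eigen [IsSimpleModule (H q) V] (hV : HasCentralCharacter q V c)
    (hc : c 0 = k + k') (hk : k * k' = 1) (hex : eigen q V k ≤ LinearMap.range (t0Sub q V k'))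
    (hne : eigen q V k ≠ ⊥) : IsAtom (eigen q V k) :=
  isAtom_iff_le_of_ge.2 ⟨hne, fun _ hW' hW => hex.trans (range_t0Sub_le hV hc hk hW hW')⟩

theorem eigen_ne_bot (hV : HasCentralCharacter q V c) (hc : c 0 = k + k') (hk : k * k' = 1)
    (hne : eigen q V k' ≠ ⊤) : eigen q V k ≠ ⊥ := by
  rw [← ker_t0Sub, Ne, LinearMap.ker_eq_top, ← LinearMap.range_eq_bot] at hne
  exact ne_bot_of_le_ne_bot hne (range_t0Sub_le_eigen hV hc hk)

theorem isCoatom_eigen [IsSimpleModule (H q) V] (hV : HasCentralCharacter q V c)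
    (hc : c 0 = k + k') (hk : k * k' = 1) (hne : eigen q V k ≠ ⊤) : IsCoatom (eigen q V k) := by
  refine isCoatom_iff_ge_of_le.2 ⟨hne, fun W hW hle => ?_⟩
  rw [← ker_t0Sub] at hle ⊢
  rw [LinearMap.le_ker_iff_map]
  by_contra hmap
  have hc' : c 0 = k' + k := hc.trans (add_comm k k')
  have hk' : k' * k = 1 := mul_comm k k' ▸ hk
  have hrange := range_t0Sub_le hV hc' hk'
    (LinearMap.map_le_range.trans (range_t0Sub_le_eigen hV hc' hk')) hmap
  rw [LinearMap.range_le_iff_comap, Submodule.comap_map_eq_self hle] at hrange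
  exact hW hrange

theorem t0Sub_t_smul_add_t_smul_t0Sub (hV : HasCentralCharacter q V c) (hc : c 0 = k + k')
    (i : ZMod 4) (v : V) :
    t0Sub q V k (H.t q i • v) + H.t q i • t0Sub q V k' v =
      H.pair q i • v - (c i * k) • v + c i • t0Sub q V k' v := by
  rw [H.pair_eq, add_smul, mul_smul, mul_smul, hV.tinv_smul i, hV.tinv_smul 0, hc]
  simp only [t0Sub_apply, smul_sub, smul_comm (H.t q i) (_ : F)]
  generalize H.t q i • H.t q 0 • v = x, H.t q 0 • H.t q i • v = y
  generalize H.t q i • v = z, H.t q 0 • v = u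
  module

theorem exists_contracting_homotopy_of_isCompl [Module.Finite F V]
    (hex : LinearMap.range (t0Sub q V k') = eigen q V k) {W : Submodule (UAW q) V}
    (hW : IsCompl (eigen q V k) W) (hW' : IsCompl (eigen q V k') W) :
    ∃ s : Module.End F V,
      (t0Sub q V k').restrictScalars F * s + s * (t0Sub q V k).restrictScalars F = 1 ∧
      (∀ x : UAW q, LinearMap.trace F V (Algebra.lsmul F F V x * s) = 0) ∧
      LinearMap.trace F V ((t0Sub q V k').restrictScalars F * s) =
        Module.finrank F (eigen q V k) := by
  rw [← hex] at hW ⊢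
  rw [← ker_t0Sub] at hex hW'
  obtain ⟨s, hes, hse, hN's, hh⟩ := exists_contracting_homotopy hex hW hW' fun w hw => by
    rw [t0Sub_apply, t0Sub_apply, sub_sub_sub_cancel_left, ← sub_smul]
    exact W.smul_of_tower_mem _ hw
  let res (f : Module.End (UAW q) V) : Module.End F V := f.restrictScalars F
  let e := Submodule.projection _ _ hW
  have he : LinearMap.IsProj ((LinearMap.range (t0Sub q V k')).restrictScalars F) (res e) :=
    ⟨Submodule.projection_apply_mem hW, fun _ => Submodule.projection_apply_of_mem_left hW⟩
  have hcomm (x : UAW q) : Commute (Algebra.lsmul F F V x) (res e) :=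
    LinearMap.ext fun v => (e.map_smul x v).symm
  exact ⟨res s, congrArg res hh,
    fun x => trace_mul_eq_zero (congrArg res hes) (congrArg res hse) (hcomm x),
    (congrArg (fun f => LinearMap.trace F V (res f)) hN's).trans he.trace⟩

theorem trace_t_of_isCompl [Module.Finite F V] (hV : HasCentralCharacter q V c)
    (hc : c 0 = k + k') (hex : LinearMap.range (t0Sub q V k') = eigen q V k)
    {W : Submodule (UAW q) V} (hW : IsCompl (eigen q V k) W) (hW' : IsCompl (eigen q V k') W)
    {i : ZMod 4} (hi : i ≠ 0) :
    LinearMap.trace F V (Algebra.lsmul F F V (H.t q i)) = c i * Module.finrank F (eigen q V k) := by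
  obtain ⟨s, hh, htr, htr_e⟩ := exists_contracting_homotopy_of_isCompl hex hW hW'
  obtain ⟨x, hx⟩ := H.pair_mem_range_zeta q hi
  set N := (t0Sub q V k).restrictScalars F
  set N' := (t0Sub q V k').restrictScalars F
  set T := Algebra.lsmul F F V (H.t q i)
  have hNT : N * T + T * N' =
      Algebra.lsmul F F V x - (c i * k) • Algebra.lsmul F F V (1 : UAW q) + c i • N' := by
    rw [map_one]
    refine LinearMap.ext fun v => (t0Sub_t_smul_add_t_smul_t0Sub hV hc i v).trans ?_
    rw [← hx]
    rfl
  rw [trace_eq_trace_mul_homotopy hh, hNT, add_mul, sub_mul, smul_mul_assoc, smul_mul_assoc,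
    map_add, map_sub, map_smul, map_smul, htr, htr, htr_e, smul_zero, sub_zero, zero_add,
    smul_eq_mul]

theorem two_mul_finrank_eigen [Module.Finite F V]
    (hex : LinearMap.range (t0Sub q V k') = eigen q V k) {W : Submodule (UAW q) V}
    (hW : IsCompl (eigen q V k) W) (hW' : IsCompl (eigen q V k') W) :
    2 * Module.finrank F (eigen q V k) = Module.finrank F V := by
  have h : Module.finrank F (eigen q V k) + Module.finrank F W = Module.finrank F V :=
    Submodule.finrank_add_eq_of_isCompl ((Submodule.isCompl_restrictScalars_iff F).2 hW)
  have h' : Module.finrank F (eigen q V k') + Module.finrank F W = Module.finrank F V :=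
    Submodule.finrank_add_eq_of_isCompl ((Submodule.isCompl_restrictScalars_iff F).2 hW')
  have hN : Module.finrank F (eigen q V k) + Module.finrank F (eigen q V k') =
      Module.finrank F V := by
    rw [← hex, ← ker_t0Sub k']
    exact ((t0Sub q V k').restrictScalars F).finrank_range_add_finrank_ker
  omega

theorem disjoint_eigen (hne : k ≠ k') : Disjoint (eigen q V k) (eigen q V k') := by
  refine Submodule.disjoint_def.2 fun v hv hv' => ?_
  have h : (k - k') • v = 0 := by rw [sub_smul, ← mem_eigen.1 hv, ← mem_eigen.1 hv', sub_self]
  exact (smul_eq_zero.1 h).resolve_left (sub_ne_zero.2 hne)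

theorem eigen_le_range_of_ne (hne : k ≠ k') : eigen q V k ≤ LinearMap.range (t0Sub q V k') := by
  intro v hv
  refine ⟨(k - k')⁻¹ • v, ?_⟩
  rw [LinearMap.map_smul_of_tower, t0Sub_apply, mem_eigen.1 hv, ← sub_smul,
    inv_smul_smul₀ (sub_ne_zero.2 hne)]

theorem eigen_le_range_of_finrank_le [Module.Finite F V] (hV : HasCentralCharacter q V c)
    (hc : c 0 = k + k') (hk : k * k' = 1)
    (hrank : Module.finrank F V ≤ Module.finrank F (LinearMap.range (t0Sub q V k)) +
      Module.finrank F (LinearMap.range (t0Sub q V k'))) :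
    eigen q V k ≤ LinearMap.range (t0Sub q V k') := by
  have hN : Module.finrank F (LinearMap.range (t0Sub q V k)) + Module.finrank F (eigen q V k) =
      Module.finrank F V := by
    rw [← ker_t0Sub k]
    exact ((t0Sub q V k).restrictScalars F).finrank_range_add_finrank_ker
  have h : (LinearMap.range (t0Sub q V k')).restrictScalars F = (eigen q V k).restrictScalars F :=
    Submodule.eq_of_le_of_finrank_le (range_t0Sub_le_eigen hV hc hk) (show
      Module.finrank F (eigen q V k) ≤ Module.finrank F (LinearMap.range (t0Sub q V k')) by omega)
  exact (Submodule.restrictScalars_injective F _ _ h).ge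

theorem eq_bot_or_eq_eigen_or_eq_top [IsSimpleModule (H q) V] [Module.Finite F V]
    (hV : HasCentralCharacter q V c) (hc : c 0 = k + k') (hk : k * k' = 1)
    (hex : eigen q V k ≤ LinearMap.range (t0Sub q V k'))
    (hex' : eigen q V k' ≤ LinearMap.range (t0Sub q V k)) (hne : ∀ a, eigen q V a ≠ ⊤) {i : ZMod 4}
    (hi : i ≠ 0) (htr : ∀ n : ℕ, 2 * n = Module.finrank F V →
      LinearMap.trace F V (Algebra.lsmul F F V (H.t q i)) ≠ c i * n)
    (W : Submodule (UAW q) V) : W = ⊥ ∨ W = eigen q V k ∨ W = eigen q V k' ∨ W = ⊤ := by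
  have hc' : c 0 = k' + k := hc.trans (add_comm k k')
  have hk' : k' * k = 1 := mul_comm k k' ▸ hk
  have hrange : LinearMap.range (t0Sub q V k') = eigen q V k :=
    (range_t0Sub_le_eigen hV hc hk).antisymm hex
  have hatom := isAtom_eigen hV hc hk hex (eigen_ne_bot hV hc hk (hne k'))
  have hatom' := isAtom_eigen hV hc' hk' hex' (eigen_ne_bot hV hc' hk' (hne k))
  obtain h | h | h | h :=
    eq_bot_or_eq_or_isCompl_or_eq_top hatom (isCoatom_eigen hV hc hk (hne k)) W
  · exact .inl h
  · exact .inr (.inl h)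
  · obtain h' | h' | h' | h' :=
      eq_bot_or_eq_or_isCompl_or_eq_top hatom' (isCoatom_eigen hV hc' hk' (hne k')) W
    · exact .inl h'
    · exact .inr (.inr (.inl h'))
    · exact absurd (trace_t_of_isCompl hV hc hrange h h' hi)
        (htr _ (two_mul_finrank_eigen hrange h h'))
    · exact .inr (.inr (.inr h'))
  · exact .inr (.inr (.inr h))

end Modules

section ModuleE

variable {F : Type*} [Field F] {q : F} {d : ℕ} {k0 k1 k2 k3 : F}

theorem vec_val (i : Fin (d + 1)) : vec F d i = Pi.basisFun F (Fin (d + 1)) i := by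
  rw [vec, dif_pos i.2, Pi.basisFun_apply]

theorem vec_apply {i j : ℕ} (hj : j < d + 1) : vec F d i ⟨j, hj⟩ = if i = j then 1 else 0 := by
  by_cases hi : i < d + 1
  · simp only [vec, dif_pos hi, Pi.single_apply, Fin.mk.injEq, eq_comm]
  · rw [vec, dif_neg hi, if_neg (by omega), Pi.zero_apply]

theorem trace_eq_sum_vec (f : Module.End F (Fin (d + 1) → F)) :
    LinearMap.trace F _ f = ∑ i : Fin (d + 1), f (vec F d i) i := by
  simp only [LinearMap.trace_eq_matrix_trace F (Pi.basisFun F (Fin (d + 1))), Matrix.trace,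
    Matrix.diag_apply, LinearMap.toMatrix_apply, vec_val, Pi.basisFun_repr]

theorem T0_apply_self (hq : q ≠ 0) (h : Admissible q d k0 k1 k2 k3) (i : Fin (d + 1)) :
    ofBasis d (act0 q d k0) (vec F d i) i =
      if Even (i : ℕ) then k0 + k0⁻¹ - k0⁻¹ * q⁻¹ ^ (i : ℕ) else k0⁻¹ * q⁻¹ ^ ((i : ℕ) + 1) := by
  obtain ⟨i, hi⟩ := i
  obtain ⟨m, rfl | rfl⟩ := Nat.even_or_odd' i
  · rw [if_pos (even_two_mul m)]
    cases m with
    | zero =>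
      simp only [mul_zero, T0_zero, Pi.smul_apply, vec_apply, if_true, pow_zero, mul_one,
        add_sub_cancel_right, smul_eq_mul]
    | succ m => simp [T0_even hq h, vec_apply, mul_add]
  · simp [T0_odd hq h, vec_apply]

theorem trace_T0 (hq : q ≠ 0) (h : Admissible q d k0 k1 k2 k3) {n : ℕ} (hn : 2 * n = d + 1) :
    LinearMap.trace F _ (ofBasis d (act0 q d k0)) = (k0 + k0⁻¹) * n + (k0 - k0⁻¹) := by
  have hsum (n : ℕ) : ∑ i ∈ Finset.range (2 * n),
      (if Even i then k0 + k0⁻¹ - k0⁻¹ * q⁻¹ ^ i else k0⁻¹ * q⁻¹ ^ (i + 1)) =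
      (k0 + k0⁻¹) * n + (k0⁻¹ * q⁻¹ ^ (2 * n) - k0⁻¹) := by
    induction n with
    | zero => simp
    | succ n ih =>
      rw [Nat.mul_succ, Finset.sum_range_succ, Finset.sum_range_succ, ih, if_pos (even_two_mul n),
        if_neg (Nat.not_even_two_mul_add_one n)]
      push_cast
      ring
  have hk0 : k0⁻¹ * q⁻¹ ^ (2 * n) = k0 := by
    rw [hn, inv_pow, ← h.sq', sq, inv_mul_cancel_left₀ h.ne0]
  simp only [trace_eq_sum_vec, T0_apply_self hq h]
  rw [← Finset.sum_range fun i =>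
    if Even i then k0 + k0⁻¹ - k0⁻¹ * q⁻¹ ^ i else k0⁻¹ * q⁻¹ ^ (i + 1), ← hn, hsum, hk0]

theorem Admissible.inv_k0_ne [NotRootOfUnity q] (h : Admissible q d k0 k1 k2 k3) :
    k0⁻¹ ≠ k0 := by
  intro hinv
  have hsq : k0 ^ 2 = 1 := by rw [pow_two, ← inv_mul_cancel₀ h.ne0, hinv]
  rw [h.sq', inv_eq_one] at hsq
  exact NotRootOfUnity.pow_ne_one (d + 1) d.succ_pos hsq

theorem vec_odd_mem_range (hq : q ≠ 0) (h : Admissible q d k0 k1 k2 k3) (m : ℕ) :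
    vec F d (2 * m + 1) ∈ LinearMap.range (ofBasis d (act1 q d k0 k1) - k1 • 1) := by
  have hk1 := h.ne1
  induction m with
  | zero =>
    refine ⟨k1 • vec F d 0, ?_⟩
    simp only [LinearMap.sub_apply, LinearMap.smul_apply, Module.End.one_apply, map_smul, T1_zero]
    rw [add_sub_cancel_left, smul_inv_smul₀ hk1]
  | succ m ih =>
    set a := k1 * (1 - q ^ (2 * m + 2)) * (1 - k0 ^ 2 * q ^ (2 * m + 2))
    have hT1 : (ofBasis d (act1 q d k0 k1) - k1 • 1) (vec F d (2 * m + 2)) =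
        k1⁻¹ • vec F d (2 * m + 3) - a • vec F d (2 * m + 1) := by
      simp only [LinearMap.sub_apply, LinearMap.smul_apply, Module.End.one_apply, T1_even hq h]
      module
    rw [← Submodule.smul_mem_iff _ (inv_ne_zero hk1), ← sub_add_cancel (k1⁻¹ • _) (a • _)]
    exact Submodule.add_mem _ ⟨_, hT1⟩ (Submodule.smul_mem _ _ ih)

theorem linearIndependent_vec_odd {n : ℕ} (hn : d = 2 * n + 1) :
    LinearIndependent F fun j : Fin (n + 1) => vec F d (2 * j + 1) := by
  let odd (j : Fin (n + 1)) : Fin (d + 1) := ⟨2 * j + 1, by omega⟩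
  have hodd : Function.Injective odd := fun i j hij => Fin.ext (by
    have := congrArg Fin.val hij
    simp only [odd] at this
    omega)
  convert (Pi.basisFun F (Fin (d + 1))).linearIndependent.comp odd hodd using 1
  exact funext fun j => vec_val (odd j)

theorem finrank_le_two_mul_finrank_range_T1_sub (hq : q ≠ 0) (h : Admissible q d k0 k1 k2 k3) :
    d + 1 ≤ 2 * Module.finrank F (LinearMap.range (ofBasis d (act1 q d k0 k1) - k1 • 1)) := by
  obtain ⟨n, hn⟩ := h.odd
  have hle := Submodule.finrank_mono (Submodule.span_le.2 (Set.range_subset_iff.2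
    fun j : Fin (n + 1) => vec_odd_mem_range hq h j))
  rw [finrank_span_eq_card (linearIndependent_vec_odd hn), Fintype.card_fin] at hle
  omega

end ModuleE

section ModuleE1

variable {F : Type*} [Field F] {q : F} {d : ℕ} {k0 k1 k2 k3 : F} (h : Admissible q d k0 k1 k2 k3)

instance : Module.Finite F (E1 h) := inferInstanceAs (Module.Finite F (Fin (d + 1) → F))

theorem finrank_E1 : Module.finrank F (E1 h) = d + 1 := Module.finrank_fin_fun F

variable [NotRootOfUnity q]

theorem t_smul_E1 (i : ZMod 4) (v : E1 h) :
    H.t q i • v = opE q d k0 k1 k2 k3 (i + 1) v := by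
  have hshift : H.shift q 1 (H.t q i) = H.t q (i + 1) := H.lift_t ..
  have hrep : repE h (H.t q (i + 1)) = opE q d k0 k1 k2 k3 (i + 1) := H.lift_t ..
  change repE h (H.shift q 1 (H.t q i)) v = _
  rw [hshift, hrep]

theorem hasCentralCharacter_E1 : HasCentralCharacter q (E1 h)
    fun i => kE k0 k1 k2 k3 (i + 1) + (kE k0 k1 k2 k3 (i + 1))⁻¹ := by
  intro i v
  have hshift : H.shift q 1 (H.tinv q i) = H.tinv q (i + 1) := H.lift_tinv ..
  have hrep : repE h (H.tinv q (i + 1)) = _ := H.lift_tinv ..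
  have htinv : H.tinv q i • v = repE h (H.shift q 1 (H.tinv q i)) v := rfl
  rw [t_smul_E1, htinv, hshift, hrep]
  exact add_sub_cancel _ _

theorem eigen_E1_ne_top (a : F) : eigen q (E1 h) a ≠ ⊤ := by
  intro htop
  have hv : H.t q 0 • (show E1 h from vec F d 0) = a • (show E1 h from vec F d 0) :=
    mem_eigen.1 (htop ▸ Submodule.mem_top)
  rw [t_smul_E1] at hv
  have hd : 1 < d + 1 := Nat.succ_lt_succ h.odd.pos
  have hv1 : (k1 • vec F d 0 + k1⁻¹ • vec F d 1) ⟨1, hd⟩ = (a • vec F d 0) ⟨1, hd⟩ :=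
    congrFun (T1_zero.symm.trans hv) _
  simp [vec_apply, h.ne1, -Fin.mk_one] at hv1

theorem trace_t_three_E1_ne {n : ℕ} (hn : 2 * n = Module.finrank F (E1 h)) :
    LinearMap.trace F (E1 h) (Algebra.lsmul F F (E1 h) (H.t q 3)) ≠ (k0 + k0⁻¹) * n := by
  have hT0 : LinearMap.trace F (E1 h) (Algebra.lsmul F F (E1 h) (H.t q 3)) =
      LinearMap.trace F (Fin (d + 1) → F) (ofBasis d (act0 q d k0)) :=
    congrArg (LinearMap.trace F (E1 h)) (LinearMap.ext fun v => t_smul_E1 h 3 v)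
  rw [hT0, trace_T0 NotRootOfUnity.ne_zero h (hn.trans (finrank_E1 h)), Ne, add_eq_left,
    sub_eq_zero]
  exact h.inv_k0_ne.symm

theorem finrank_E1_le_two_mul_finrank_range :
    Module.finrank F (E1 h) ≤ 2 * Module.finrank F (LinearMap.range (t0Sub q (E1 h) k1)) := by
  let T : Module.End F (E1 h) := ofBasis d (act1 q d k0 k1)
  let N : Module.End F (E1 h) := T - k1 • 1
  have hN : (t0Sub q (E1 h) k1).restrictScalars F = N :=
    LinearMap.ext fun v => congrArg (· - k1 • v) (t_smul_E1 h 0 v)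
  have hrank : d + 1 ≤ 2 * Module.finrank F (LinearMap.range N) :=
    finrank_le_two_mul_finrank_range_T1_sub NotRootOfUnity.ne_zero h
  rwa [← hN, ← finrank_E1 h] at hrank

theorem eigen_E1_le_range : eigen q (E1 h) k1 ≤ LinearMap.range (t0Sub q (E1 h) k1⁻¹) := by
  by_cases hk : k1 = k1⁻¹
  · refine eigen_le_range_of_finrank_le (hasCentralCharacter_E1 h) rfl (mul_inv_cancel₀ h.ne1) ?_
    rw [← hk, ← two_mul]
    exact finrank_E1_le_two_mul_finrank_range h
  · exact eigen_le_range_of_ne hk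

theorem eigen_inv_E1_le_range : eigen q (E1 h) k1⁻¹ ≤ LinearMap.range (t0Sub q (E1 h) k1) := by
  by_cases hk : k1⁻¹ = k1
  · simpa only [hk] using eigen_E1_le_range h
  · exact eigen_le_range_of_ne hk

end ModuleE1

end DAHA

theorem mainTheorem5_general {F : Type*} [Field F] (q : F) [DAHA.NotRootOfUnity q]
    (d : ℕ) (k0 k1 k2 k3 : F) (h : DAHA.Admissible q d k0 k1 k2 k3)
    (hirr : IsSimpleModule (DAHA.H q) (DAHA.E1 h)) :
    (k1 ^ 2 = 1 →
      (∀ W : Submodule (DAHA.UAW q) (DAHA.E1 h),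
        W = ⊥ ∨ W = DAHA.eigen q (DAHA.E1 h) k1 ∨ W = ⊤) ∧
      ⊥ ⋖ DAHA.eigen q (DAHA.E1 h) k1 ∧
      DAHA.eigen q (DAHA.E1 h) k1 ⋖ ⊤) ∧
    (k1 ^ 2 ≠ 1 →
      (∀ W : Submodule (DAHA.UAW q) (DAHA.E1 h),
        W = ⊥ ∨ W = DAHA.eigen q (DAHA.E1 h) k1 ∨ W = DAHA.eigen q (DAHA.E1 h) k1⁻¹ ∨ W = ⊤) ∧
      DAHA.eigen q (DAHA.E1 h) k1 ≠ DAHA.eigen q (DAHA.E1 h) k1⁻¹ ∧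
      ⊥ ⋖ DAHA.eigen q (DAHA.E1 h) k1 ∧
      ⊥ ⋖ DAHA.eigen q (DAHA.E1 h) k1⁻¹ ∧
      DAHA.eigen q (DAHA.E1 h) k1 ⋖ ⊤ ∧
      DAHA.eigen q (DAHA.E1 h) k1⁻¹ ⋖ ⊤) := by
  have hV := DAHA.hasCentralCharacter_E1 h
  have hc' : k1 + k1⁻¹ = k1⁻¹ + k1 := add_comm _ _
  have hk := mul_inv_cancel₀ h.ne1
  have hk' := inv_mul_cancel₀ h.ne1
  have hex := DAHA.eigen_E1_le_range h
  have hex' := DAHA.eigen_inv_E1_le_range h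
  have hne := DAHA.eigen_E1_ne_top h
  have hatom := DAHA.isAtom_eigen hV (k := k1) rfl hk hex (DAHA.eigen_ne_bot hV rfl hk (hne _))
  have hatom' := DAHA.isAtom_eigen hV hc' hk' hex' (DAHA.eigen_ne_bot hV hc' hk' (hne _))
  have hcoatom := DAHA.isCoatom_eigen hV (k := k1) rfl hk (hne _)
  have hcoatom' := DAHA.isCoatom_eigen hV hc' hk' (hne _)
  have hall := DAHA.eq_bot_or_eq_eigen_or_eq_top hV (k := k1) (k' := k1⁻¹) rfl hk hex hex' hne
    (i := 3) (by decide) fun n hn => DAHA.trace_t_three_E1_ne h hn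
  refine ⟨fun hsq => ⟨fun W => ?_, hatom.bot_covBy, hcoatom.covBy_top⟩, fun hsq => ⟨hall,
    (DAHA.disjoint_eigen fun e => hsq ?_).ne hatom.1, hatom.bot_covBy, hatom'.bot_covBy,
    hcoatom.covBy_top, hcoatom'.covBy_top⟩⟩
  · have hinv : k1⁻¹ = k1 := inv_eq_of_mul_eq_one_left (sq k1 ▸ hsq)
    simpa only [hinv, or_self_left] using hall W
  · rw [sq, mul_eq_one_iff_eq_inv₀ h.ne1]
    exact e

theorem mainTheorem5 {F : Type*} [Field F] [IsAlgClosed F] (q : F) [DAHA.NotRootOfUnity q]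
    (d : ℕ) (k0 k1 k2 k3 : F) (h : DAHA.Admissible q d k0 k1 k2 k3)
    (hirr : IsSimpleModule (DAHA.H q) (DAHA.E1 h)) :
    (k1 ^ 2 = 1 →
      (∀ W : Submodule (DAHA.UAW q) (DAHA.E1 h),
        W = ⊥ ∨ W = DAHA.eigen q (DAHA.E1 h) k1 ∨ W = ⊤) ∧
      ⊥ ⋖ DAHA.eigen q (DAHA.E1 h) k1 ∧
      DAHA.eigen q (DAHA.E1 h) k1 ⋖ ⊤) ∧
    (k1 ^ 2 ≠ 1 →
      (∀ W : Submodule (DAHA.UAW q) (DAHA.E1 h),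
        W = ⊥ ∨ W = DAHA.eigen q (DAHA.E1 h) k1 ∨ W = DAHA.eigen q (DAHA.E1 h) k1⁻¹ ∨ W = ⊤) ∧
      DAHA.eigen q (DAHA.E1 h) k1 ≠ DAHA.eigen q (DAHA.E1 h) k1⁻¹ ∧
      ⊥ ⋖ DAHA.eigen q (DAHA.E1 h) k1 ∧
      ⊥ ⋖ DAHA.eigen q (DAHA.E1 h) k1⁻¹ ∧
      DAHA.eigen q (DAHA.E1 h) k1 ⋖ ⊤ ∧
      DAHA.eigen q (DAHA.E1 h) k1⁻¹ ⋖ ⊤) :=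
  mainTheorem5_general q d k0 k1 k2 k3 h hirr
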